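/- Write points of $\mathbb{R}^6$ as $(p,q)$ with $p,q\in\mathbb{R}^3$, let $u(p,q)=\tfrac12(|p|^2-|q|^2)$, and let $$\Phi(p,q,z)=\frac{\left((|p|+|q|)^2+2z^2\right)^{3/2}-\left((|p|-|q|)^2+2z^2\right)^{3/2}}{2^{5/2}|p||q|},\qquad p,q\in\mathbb{R}^3,\ z\in\mathbb{R},$$ extended continuously to $\{|p||q|=0\}$. Let $$\Phi_0(p,q)=\Phi(p,q,0)=\frac{\bigl||p|+|q|\bigr|^3-\bigl||p|-|q|\bigr|^3}{2^{5/2}|p||q|}$$ (again extended continuously) be the restriction of $\Phi$ to $\{z=0\}$, and for an oriented hypersurface $\Sigma\subset\mathbb{R}^6$ with unit normal $\nu$ let $A_{\Phi_0}(\Sigma)=\int_\Sigma\Phi_0(\nu)$. Hypersurfaces are understood in the weak sense: $\Sigma$ is the oriented boundary of an integer-valued locally integrable function $g$ on $\mathbb{R}^6$ of locally bounded variation, with area measure and normal given by the polar decomposition $-Dg=\nu\,|Dg|$, so that $A_{\Phi_0}(\Sigma\cap U)=\int_U\Phi_0(\nu)\,d|Dg|$; the boundary of a set $E$ is the case $g=1_E$.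 1. The cone $C$ over $S^2\times S^2$, that is $C=\{|p|=|q|\}=\partial\{u<0\}$, minimizes $A_{\Phi_0}$: for every bounded open $U\subset\mathbb{R}^6$, $A_{\Phi_0}(C\cap U)<\infty$ and $A_{\Phi_0}(C\cap U)\le A_{\Phi_0}(\Sigma\cap U)$ for every $\Sigma$, the oriented boundary of some $g$ as above, such that the closure of $\{g\neq 1_{\{u<0\}}\}$ is contained in $U$. 2. The hypersurfaces $\{u=1\}=\partial\{u<1\}$ and $\{u=-1\}=\partial\{u<-1\}$ are critical points of $A_{\Phi_0}$: for every smooth compactly supported vector field $X$ on $\mathbb{R}^6$ and every bounded open $U$ containing the support of $X$, the $A_{\Phi_0}$-energy in $U$ of the image of the hypersurface under $x\mapsto x+tX(x)$ is finite for small $|t|$ and has derivative $0$ with respect to $t$ at $t=0$. 3. The dilations of $\{u=1\}$ and of $\{u=-1\}$ foliate the two sides $\{u>0\}$ and $\{u<0\}$ of $C$, respectively: the sets $r\{u=1\}$, $r>0$, are the level sets $\{\rho=r\}$ of a smooth function $\rho:\{u>0\}\to(0,\infty)$ without critical points, and likewise for $\{u=-1\}$ and $\{u<0\}$. -/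

import Mathlib

open MeasureTheory Set Filter Topology
open scoped ENNReal ContDiff Pointwise

namespace ParametricFunctional

section General

variable {ι : Type*} [Fintype ι]

/-- The divergence of a vector field. -/
noncomputable def divergence (X : EuclideanSpace ℝ ι → EuclideanSpace ℝ ι)
    (x : EuclideanSpace ℝ ι) : ℝ :=
  ∑ i, (fderiv ℝ X x (EuclideanSpace.basisFun ι ℝ i)) i

/-- `μ` is the area measure and `ν` the unit normal of the oriented hypersurface (a codimension-one
cycle, counted with integer multiplicity) that is the boundary of the integer multiplicity
function `g`: the Gauss-Green formula `∫ g div X = ∫ X · ν dμ` holds for all compactly supported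
`C¹` vector fields. For `g` the indicator function of a set `E` with smooth boundary, `μ` is the
surface measure of `∂E` and `ν` is the outer unit normal; in general this says that `g` has locally
bounded variation and that `-Dg = ν μ` is the polar decomposition. The measure `μ` is determined
by `g`, and `ν` is determined up to a `μ`-null set. -/
structure IsBoundary (g : EuclideanSpace ℝ ι → ℤ) (μ : Measure (EuclideanSpace ℝ ι))
    (ν : EuclideanSpace ℝ ι → EuclideanSpace ℝ ι) : Prop where
  locallyIntegrable : LocallyIntegrable (fun x => (g x : ℝ)) volume
  locallyFinite : IsLocallyFiniteMeasure μ
  measurable_normal : Measurable ν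
  norm_normal : ∀ᵐ x ∂μ, ‖ν x‖ = 1
  gauss_green : ∀ X : EuclideanSpace ℝ ι → EuclideanSpace ℝ ι,
    ContDiff ℝ 1 X → HasCompactSupport X →
      ∫ x, (g x : ℝ) * divergence X x = ∫ x, inner ℝ (X x) (ν x) ∂μ

/-- The parametric functional `A_Φ(Σ ∩ U) = ∫_{Σ ∩ U} Φ(ν)` of the part in `U` of the oriented
hypersurface `Σ` that is the boundary of `g`. All pairs `(μ, ν)` in the infimum give the same
value; the functional is `∞` if `g` does not have locally bounded variation. -/
noncomputable def functional (Φ : EuclideanSpace ℝ ι → ℝ) (g : EuclideanSpace ℝ ι → ℤ)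
    (U : Set (EuclideanSpace ℝ ι)) : ℝ≥0∞ :=
  ⨅ (μ : Measure (EuclideanSpace ℝ ι)) (ν : EuclideanSpace ℝ ι → EuclideanSpace ℝ ι)
    (_ : IsBoundary g μ ν), ∫⁻ x in U, ENNReal.ofReal (Φ (ν x)) ∂μ

/-- The multiplicity function of a set. -/
noncomputable def mult (E : Set (EuclideanSpace ℝ ι)) : EuclideanSpace ℝ ι → ℤ :=
  E.indicator 1

/-- The oriented boundary of `E` minimizes `A_Φ`: in every bounded open set `U` its `A_Φ`-energy is
finite and at most that of any oriented hypersurface, possibly with integer multiplicities, which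
is obtained from it by a modification compactly contained in `U`. -/
def IsMinimizer (Φ : EuclideanSpace ℝ ι → ℝ) (E : Set (EuclideanSpace ℝ ι)) : Prop :=
  ∀ U : Set (EuclideanSpace ℝ ι), IsOpen U → Bornology.IsBounded U →
    functional Φ (mult E) U ≠ ⊤ ∧
    ∀ g : EuclideanSpace ℝ ι → ℤ, closure {x | g x ≠ mult E x} ⊆ U →
      functional Φ (mult E) U ≤ functional Φ g U

/-- The oriented boundary of `E` is a critical point of `A_Φ`: the first variation of `A_Φ` along
the deformations `x ↦ x + t X(x)` vanishes for every smooth compactly supported vector field. -/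
def IsCriticalPoint (Φ : EuclideanSpace ℝ ι → ℝ) (E : Set (EuclideanSpace ℝ ι)) : Prop :=
  ∀ X : EuclideanSpace ℝ ι → EuclideanSpace ℝ ι, ContDiff ℝ ∞ X → HasCompactSupport X →
  ∀ U : Set (EuclideanSpace ℝ ι), IsOpen U → Bornology.IsBounded U → tsupport X ⊆ U →
    (∀ᶠ t : ℝ in 𝓝 0, functional Φ (mult ((fun x => x + t • X x) '' E)) U ≠ ⊤) ∧
    HasDerivAt (fun t : ℝ => (functional Φ (mult ((fun x => x + t • X x) '' E)) U).toReal) 0 0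

/-- The dilations `r • S`, `r > 0`, are the leaves of a smooth foliation by hypersurfaces of the open
set `Ω`: they are the level sets of a smooth submersion `Ω → (0, ∞)`. -/
def DilationsFoliate (S Ω : Set (EuclideanSpace ℝ ι)) : Prop :=
  IsOpen Ω ∧ ∃ ρ : EuclideanSpace ℝ ι → ℝ, ContDiffOn ℝ ∞ ρ Ω ∧
    (∀ x ∈ Ω, 0 < ρ x ∧ fderiv ℝ ρ x ≠ 0) ∧
    ∀ r : ℝ, 0 < r → r • S = {x ∈ Ω | ρ x = r}

end General

/-- `ℝ³`. -/
abbrev R3 : Type := EuclideanSpace ℝ (Fin 3)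

/-- `ℝ⁶`, with points `x = (p, q)`, `p, q ∈ ℝ³`. -/
abbrev R6 : Type := EuclideanSpace ℝ (Fin 3 ⊕ Fin 3)

/-- The component `p` of `x = (p, q)`. -/
noncomputable def pPart (x : R6) : R3 := WithLp.toLp 2 fun i => x (Sum.inl i)

/-- The component `q` of `x = (p, q)`. -/
noncomputable def qPart (x : R6) : R3 := WithLp.toLp 2 fun i => x (Sum.inr i)

/-- The integrand `Φ` on `ℝ⁷`: with `D = (((|p| + |q|)² + 2 z²) / 2)^{1/2}` and
`E = (((|p| - |q|)² + 2 z²) / 2)^{1/2}` it is `(D² + D E + E²) / (D + E)`. -/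
noncomputable def Phi (p q : R3) (z : ℝ) : ℝ :=
  let D := √(((‖p‖ + ‖q‖) ^ 2 + 2 * z ^ 2) / 2)
  let E := √(((‖p‖ - ‖q‖) ^ 2 + 2 * z ^ 2) / 2)
  (D ^ 2 + D * E + E ^ 2) / (D + E)

/-- The restriction of `Φ` to `{z = 0}`. -/
noncomputable def Phi0 (x : R6) : ℝ := Phi (pPart x) (qPart x) 0

/-- The closed formula for `Φ`; `Phi` is its continuous extension to `{|p| |q| = 0}`. -/
theorem Phi_eq (p q : R3) (z : ℝ) (hp : p ≠ 0) (hq : q ≠ 0) :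
    Phi p q z = (((‖p‖ + ‖q‖) ^ 2 + 2 * z ^ 2) ^ (3 / 2 : ℝ)
      - ((‖p‖ - ‖q‖) ^ 2 + 2 * z ^ 2) ^ (3 / 2 : ℝ)) / (2 ^ (5 / 2 : ℝ) * ‖p‖ * ‖q‖) := by
  have hP : 0 < ‖p‖ := norm_pos_iff.2 hp
  have hQ : 0 < ‖q‖ := norm_pos_iff.2 hq
  have key : ∀ a : ℝ, 0 ≤ a → a ^ (3 / 2 : ℝ) = 2 ^ (3 / 2 : ℝ) * √(a / 2) ^ 3 := by
    intro a ha
    have h1 : √(a / 2) ^ 3 = (a / 2) ^ (3 / 2 : ℝ) := by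
      rw [Real.sqrt_eq_rpow, ← Real.rpow_natCast, ← Real.rpow_mul (by positivity)]
      norm_num
    rw [h1, ← Real.mul_rpow (by norm_num) (by positivity)]
    congr 1
    ring
  have h52 : (2 : ℝ) ^ (5 / 2 : ℝ) = 2 * 2 ^ (3 / 2 : ℝ) := by
    rw [show (5 / 2 : ℝ) = 1 + 3 / 2 by norm_num, Real.rpow_add (by norm_num), Real.rpow_one]
  rw [key ((‖p‖ + ‖q‖) ^ 2 + 2 * z ^ 2) (by positivity),
    key ((‖p‖ - ‖q‖) ^ 2 + 2 * z ^ 2) (by positivity), h52]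
  simp only [Phi]
  set D := √(((‖p‖ + ‖q‖) ^ 2 + 2 * z ^ 2) / 2) with hD
  set E := √(((‖p‖ - ‖q‖) ^ 2 + 2 * z ^ 2) / 2) with hE
  have hDpos : 0 < D := Real.sqrt_pos.2 (by positivity)
  have hEnn : 0 ≤ E := Real.sqrt_nonneg _
  have hD2 : D ^ 2 = ((‖p‖ + ‖q‖) ^ 2 + 2 * z ^ 2) / 2 := Real.sq_sqrt (by positivity)
  have hE2 : E ^ 2 = ((‖p‖ - ‖q‖) ^ 2 + 2 * z ^ 2) / 2 := Real.sq_sqrt (by positivity)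
  have hDE : D ^ 2 - E ^ 2 = 2 * ‖p‖ * ‖q‖ := by rw [hD2, hE2]; ring
  have h32 : (0 : ℝ) < 2 ^ (3 / 2 : ℝ) := by positivity
  have hden : 2 * (2 : ℝ) ^ (3 / 2 : ℝ) * ‖p‖ * ‖q‖ = 2 ^ (3 / 2 : ℝ) * ((D - E) * (D + E)) := by
    linear_combination (-(2 : ℝ) ^ (3 / 2 : ℝ)) * hDE
  rw [hden, ← mul_sub, mul_div_mul_left _ _ h32.ne']
  have hne : (D - E) * (D + E) ≠ 0 := by
    have : (D - E) * (D + E) = 2 * ‖p‖ * ‖q‖ := by linear_combination hDE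
    rw [this]; positivity
  rw [div_eq_div_iff (by positivity) hne]
  ring

theorem Phi_continuous : Continuous fun a : R3 × R3 × ℝ => Phi a.1 a.2.1 a.2.2 := by
  rw [continuous_iff_continuousAt]
  intro a
  have hD : Continuous fun a : R3 × R3 × ℝ => √(((‖a.1‖ + ‖a.2.1‖) ^ 2 + 2 * a.2.2 ^ 2) / 2) := by
    fun_prop
  have hE : Continuous fun a : R3 × R3 × ℝ => √(((‖a.1‖ - ‖a.2.1‖) ^ 2 + 2 * a.2.2 ^ 2) / 2) := by
    fun_prop
  by_cases h : √(((‖a.1‖ + ‖a.2.1‖) ^ 2 + 2 * a.2.2 ^ 2) / 2)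
      + √(((‖a.1‖ - ‖a.2.1‖) ^ 2 + 2 * a.2.2 ^ 2) / 2) = 0
  · have h0 : Phi a.1 a.2.1 a.2.2 = 0 := by simp only [Phi, h, div_zero]
    have ht := (hD.add hE).tendsto a
    simp only [Pi.add_apply] at ht
    rw [h] at ht
    change Tendsto _ _ (𝓝 (Phi a.1 a.2.1 a.2.2))
    rw [h0]
    refine squeeze_zero (fun b => ?_) (fun b => ?_) ht
    · simp only [Phi]; positivity
    · simp only [Phi, Pi.add_apply]
      have h1 := Real.sqrt_nonneg (((‖b.1‖ + ‖b.2.1‖) ^ 2 + 2 * b.2.2 ^ 2) / 2)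
      have h2 := Real.sqrt_nonneg (((‖b.1‖ - ‖b.2.1‖) ^ 2 + 2 * b.2.2 ^ 2) / 2)
      refine div_le_of_le_mul₀ (by positivity) (by positivity) ?_
      nlinarith [mul_nonneg h1 h2]
  · unfold Phi
    exact ((((hD.pow 2).add (hD.mul hE)).add (hE.pow 2)).continuousAt).div
      (hD.add hE).continuousAt h

/-- The quadratic polynomial `u(p, q) = (|p|² - |q|²) / 2`. -/
noncomputable def quadU (x : R6) : ℝ := (‖pPart x‖ ^ 2 - ‖qPart x‖ ^ 2) / 2

/-- The cone over `S² × S²`. -/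
def coneS2S2 : Set R6 :=
  {x | ∃ (r : ℝ) (y : R6), 0 ≤ r ∧ ‖pPart y‖ = 1 ∧ ‖qPart y‖ = 1 ∧ x = r • y}

end ParametricFunctional

open ParametricFunctional

/-! The proof is a calibration argument that treats all level sets of `u` at once. By `Phi0_eq`,
`2√2 Φ₀ = 3 max + min² / max` in terms of `|p|` and `|q|`, and this is the maximum over `τ ∈ [0, 1]`
of the linear expressions `(3 - τ²) a + 2 τ b`, where `(a, b)` is `(|p|, |q|)` or `(|q|, |p|)`
(`le_max_profile`, `exists_max_profile_eq`).

Off the cone the natural calibration is `∇Φ₀(∇u)`. Up to the factor `2√2` it is `((3r² - |q|²) r⁻³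
p, -(3r² - |p|²) r⁻³ q)` with `r = max(|p|, |q|)`. This field is homogeneous of degree zero, hence
singular at the origin. Here `r²` is the larger root `h` of `(h - |p|²)(h - |q|²) = 0`; replacing
the right side by `h w`, `w > 0`, gives smooth fields `calib w` on all of `ℝ⁶` that are still
exactly divergence free (`divergence_calib`) and still satisfy `⟨calib w x, v⟩ ≤ Φ₀(v)` for all `v`
(`inner_calib_le`). As `w → 0`, equality is attained for `v = ∇u(x)` (`tendsto_inner_calib`).

The Gauss-Green formula on `{u < c}` and on its diffeomorphic images comes from the coarea formula
for `u` (`integral_eq_integral_leafMeasure`) and a smooth approximation of the indicator function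
(`integral_sublevel`). Testing with `η • calib w`, where `η` is constant near the modification,
yields `lintegral_gradU_le_functional`: the energy of `{u = c}` is at most that of every competitor.
The bound holds for every admissible pair `(μ, ν)` and is attained by an explicit one, so uniqueness
of the polar decomposition is never used. The case `c = 0` is the minimality of the cone.

For `c ≠ 0` criticality also follows from minimality. The energy of the deformed hypersurface lies
between the undeformed energy and an explicit integral `deformEnergy`, which is differentiable at `t
= 0` and has a local minimum there; hence the energy itself has derivative zero. The foliation is
given by `ρ = √(±u)`, because `u` is homogeneous of degree two. -/

namespace ParametricFunctional

/-! ### The decomposition of `ℝ⁶` -/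

/-- The point `(p, q)` of `ℝ⁶`. -/
noncomputable def join (p q : R3) : R6 := WithLp.toLp 2 (Sum.elim p q)

@[simp] theorem pPart_join (p q : R3) : pPart (join p q) = p := by
  ext i; simp [pPart, join]

@[simp] theorem qPart_join (p q : R3) : qPart (join p q) = q := by
  ext i; simp [qPart, join]

@[simp] theorem join_pPart_qPart (x : R6) : join (pPart x) (qPart x) = x := by
  ext i; rcases i with i | i <;> simp [pPart, qPart, join]

@[simp] theorem pPart_smul (c : ℝ) (x : R6) : pPart (c • x) = c • pPart x := rfl
@[simp] theorem qPart_smul (c : ℝ) (x : R6) : qPart (c • x) = c • qPart x := rfl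
@[simp] theorem pPart_add (x y : R6) : pPart (x + y) = pPart x + pPart y := rfl
@[simp] theorem qPart_add (x y : R6) : qPart (x + y) = qPart x + qPart y := rfl
@[simp] theorem pPart_sub (x y : R6) : pPart (x - y) = pPart x - pPart y := rfl
@[simp] theorem qPart_sub (x y : R6) : qPart (x - y) = qPart x - qPart y := rfl

theorem inner_eq_add (x y : R6) :
    inner ℝ x y = inner ℝ (pPart x) (pPart y) + inner ℝ (qPart x) (qPart y) := by
  simp [PiLp.inner_apply, pPart, qPart]

theorem norm_sq_eq_add (x : R6) : ‖x‖ ^ 2 = ‖pPart x‖ ^ 2 + ‖qPart x‖ ^ 2 := by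
  rw [← real_inner_self_eq_norm_sq, inner_eq_add, real_inner_self_eq_norm_sq,
    real_inner_self_eq_norm_sq]

theorem norm_pPart_le (x : R6) : ‖pPart x‖ ≤ ‖x‖ :=
  le_of_sq_le_sq (by nlinarith [norm_sq_eq_add x, sq_nonneg ‖qPart x‖]) (norm_nonneg _)

theorem norm_qPart_le (x : R6) : ‖qPart x‖ ≤ ‖x‖ :=
  le_of_sq_le_sq (by nlinarith [norm_sq_eq_add x, sq_nonneg ‖pPart x‖]) (norm_nonneg _)

theorem contDiff_pPart {n : WithTop ℕ∞} : ContDiff ℝ n pPart := by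
  rw [contDiff_piLp]
  intro i
  exact contDiff_piLp_apply (p := 2) (i := Sum.inl i)

theorem contDiff_qPart {n : WithTop ℕ∞} : ContDiff ℝ n qPart := by
  rw [contDiff_piLp]
  intro i
  exact contDiff_piLp_apply (p := 2) (i := Sum.inr i)

@[fun_prop] theorem continuous_pPart : Continuous pPart := (contDiff_pPart (n := 0)).continuous
@[fun_prop] theorem continuous_qPart : Continuous qPart := (contDiff_qPart (n := 0)).continuous

theorem contDiff_join {n : WithTop ℕ∞} : ContDiff ℝ n fun a : R3 × R3 => join a.1 a.2 := by
  rw [contDiff_piLp]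
  rintro (i | i)
  · exact (contDiff_piLp_apply (p := 2) (i := i)).comp contDiff_fst
  · exact (contDiff_piLp_apply (p := 2) (i := i)).comp contDiff_snd

theorem continuous_join : Continuous fun a : R3 × R3 => join a.1 a.2 :=
  (contDiff_join (n := 0)).continuous

/-- The gradient of `quadU`. -/
noncomputable def gradU (x : R6) : R6 := join (pPart x) (-qPart x)

@[simp] theorem pPart_gradU (x : R6) : pPart (gradU x) = pPart x := pPart_join _ _
@[simp] theorem qPart_gradU (x : R6) : qPart (gradU x) = -qPart x := qPart_join _ _

theorem contDiff_gradU {n : WithTop ℕ∞} : ContDiff ℝ n gradU :=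
  contDiff_join.comp (contDiff_pPart.prodMk contDiff_qPart.neg)

@[fun_prop] theorem continuous_gradU : Continuous gradU := (contDiff_gradU (n := 0)).continuous

theorem norm_gradU (x : R6) : ‖gradU x‖ = ‖x‖ := by
  have h : ‖gradU x‖ ^ 2 = ‖x‖ ^ 2 := by simp [norm_sq_eq_add]
  exact (sq_eq_sq₀ (norm_nonneg _) (norm_nonneg _)).1 h

theorem quadU_eq_inner (x : R6) : quadU x = inner ℝ (gradU x) x / 2 := by
  simp [inner_eq_add, quadU, sub_eq_add_neg]

theorem contDiff_quadU {n : WithTop ℕ∞} : ContDiff ℝ n quadU := by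
  have : quadU = fun x => inner ℝ (gradU x) x / 2 := funext quadU_eq_inner
  rw [this]
  exact (contDiff_gradU.inner ℝ contDiff_id).div_const 2

@[fun_prop] theorem continuous_quadU : Continuous quadU := (contDiff_quadU (n := 0)).continuous

theorem hasFDerivAt_quadU (x : R6) : HasFDerivAt quadU (innerSL ℝ (gradU x)) x := by
  have hd : DifferentiableAt ℝ quadU x := (contDiff_quadU (n := 1)).differentiable one_ne_zero x
  have : fderiv ℝ quadU x = innerSL ℝ (gradU x) := by
    ext v
    have h1 : HasDerivAt (fun t : ℝ => quadU (x + t • v)) (fderiv ℝ quadU x v) 0 := by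
      have hl : HasDerivAt (fun t : ℝ => x + t • v) v 0 := by
        simpa using ((hasDerivAt_id (0 : ℝ)).smul_const v).const_add x
      have h0 : HasFDerivAt quadU (fderiv ℝ quadU x) (x + (0 : ℝ) • v) := by
        simpa using hd.hasFDerivAt
      exact h0.comp_hasDerivAt 0 hl
    have h2 : HasDerivAt (fun t : ℝ => quadU x + t * inner ℝ (gradU x) v + t ^ 2 * quadU v)
        (inner ℝ (gradU x) v) 0 := by
      have := (((hasDerivAt_id (0 : ℝ)).mul_const (inner ℝ (gradU x) v)).const_add (quadU x)).add
        (((hasDerivAt_id (0 : ℝ)).pow 2).mul_const (quadU v))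
      simpa using! this
    have h3 : (fun t : ℝ => quadU (x + t • v))
        = fun t : ℝ => quadU x + t * inner ℝ (gradU x) v + t ^ 2 * quadU v := by
      funext t
      simp only [quadU, pPart_add, qPart_add, pPart_smul, qPart_smul, norm_add_sq_real,
        inner_smul_right, norm_smul, inner_eq_add, pPart_gradU, qPart_gradU, inner_neg_left,
        mul_pow, Real.norm_eq_abs, sq_abs]
      ring
    rw [h3] at h1
    simpa using h1.unique h2
  rw [← this]
  exact hd.hasFDerivAt

theorem quadU_smul (r : ℝ) (x : R6) : quadU (r • x) = r ^ 2 * quadU x := by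
  simp [quadU, norm_smul, mul_pow]; ring

/-! ### The integrand -/

/-- For `z = 0` the two square roots are `(|p| + |q|) / √2` and `||p| - |q|| / √2`, so their sum is
`√2 max` and their product is `(max² - min²) / 2`. At the origin both sides vanish since division by
zero gives zero. -/
theorem Phi0_eq (x : R6) :
    2 * √2 * Phi0 x = 3 * max ‖pPart x‖ ‖qPart x‖
      + min ‖pPart x‖ ‖qPart x‖ ^ 2 / max ‖pPart x‖ ‖qPart x‖ := by
  have key : ∀ a b : ℝ, 0 ≤ b → b ≤ a →
      2 * √2 * (((a + b) ^ 2 / 2 + (a + b) / √2 * ((a - b) / √2) + (a - b) ^ 2 / 2)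
        / ((a + b) / √2 + (a - b) / √2)) = 3 * a + b ^ 2 / a := by
    intro a b hb hab
    have h2 : √2 * √2 = (2 : ℝ) := Real.mul_self_sqrt (by norm_num)
    have h2p : 0 < √(2 : ℝ) := by positivity
    rcases (hb.trans hab).eq_or_lt with h | h
    · subst h
      have : b = 0 := le_antisymm hab hb
      subst this; simp
    · have e1 : (a + b) / √2 * ((a - b) / √2) = (a ^ 2 - b ^ 2) / 2 := by
        rw [div_mul_div_comm, h2]; ring
      have e2 : (a + b) / √2 + (a - b) / √2 = 2 * a / √2 := by ring
      rw [e1, e2]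
      field_simp
      rw [Real.sq_sqrt (by norm_num)]
      ring
  have hs : ∀ y : ℝ, √((y ^ 2 + 2 * (0 : ℝ) ^ 2) / 2) = |y| / √2 := by
    intro y
    rw [show (y ^ 2 + 2 * (0 : ℝ) ^ 2) / 2 = y ^ 2 / 2 by ring, Real.sqrt_div (sq_nonneg y),
      Real.sqrt_sq_eq_abs]
  have hd : ∀ y : ℝ, (|y| / √2) ^ 2 = y ^ 2 / 2 := by
    intro y; rw [div_pow, sq_abs, Real.sq_sqrt (by norm_num)]
  simp only [Phi0, Phi, hs, hd]
  have hP := norm_nonneg (pPart x)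
  have hQ := norm_nonneg (qPart x)
  rw [abs_of_nonneg (add_nonneg hP hQ)]
  rcases le_total ‖qPart x‖ ‖pPart x‖ with h | h
  · rw [abs_of_nonneg (sub_nonneg.2 h), max_eq_left h, min_eq_right h]
    exact key _ _ hQ h
  · rw [abs_of_nonpos (sub_nonpos.2 h), max_eq_right h, min_eq_left h, ← key _ _ hP h,
      show -(‖pPart x‖ - ‖qPart x‖) = ‖qPart x‖ - ‖pPart x‖ by ring,
      add_comm ‖qPart x‖ ‖pPart x‖]
    ring

theorem Phi0_smul (c : ℝ) (x : R6) : Phi0 (c • x) = |c| * Phi0 x := by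
  have h : 2 * √2 * Phi0 (c • x) = 2 * √2 * (|c| * Phi0 x) := by
    rw [mul_left_comm (2 * √2) |c|, Phi0_eq, Phi0_eq]
    simp only [pPart_smul, qPart_smul, norm_smul, Real.norm_eq_abs,
      ← mul_max_of_nonneg _ _ (abs_nonneg c), ← mul_min_of_nonneg _ _ (abs_nonneg c)]
    rcases eq_or_ne c 0 with rfl | hc
    · simp
    · have : |c| ≠ 0 := abs_ne_zero.2 hc
      rw [mul_add, mul_pow, sq |c|, mul_assoc |c| |c|, mul_div_mul_left _ _ this]
      ring
  exact mul_left_cancel₀ (by positivity) h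

theorem Phi0_neg (x : R6) : Phi0 (-x) = Phi0 x := by
  simpa using Phi0_smul (-1) x

theorem Phi0_nonneg (x : R6) : 0 ≤ Phi0 x := by
  simp only [Phi0, Phi]; positivity

/-- After multiplication by `P` the first gap is the square `(Q - τP)²`, and the second is `(P - Q)
P (1 - τ²) + P² (1 - τ)² + (P - Q)²`. -/
theorem le_profile_of_le {P Q τ : ℝ} (hP : 0 < P) (h : Q ≤ P) (h0 : 0 ≤ τ)
    (h1 : τ ≤ 1) :
    (3 - τ ^ 2) * P + 2 * τ * Q ≤ 3 * P + Q ^ 2 / P ∧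
      (3 - τ ^ 2) * Q + 2 * τ * P ≤ 3 * P + Q ^ 2 / P := by
  have h4 : τ ^ 2 ≤ 1 := pow_le_one₀ h0 h1
  have h2 : 0 ≤ (P - Q) * P * (1 - τ ^ 2) :=
    mul_nonneg (mul_nonneg (sub_nonneg.2 h) hP.le) (sub_nonneg.2 h4)
  have h3 : 0 ≤ P ^ 2 * (1 - τ) ^ 2 := by positivity
  constructor
  · rw [← sub_le_iff_le_add', le_div_iff₀ hP]
    linarith [sq_nonneg (Q - τ * P)]
  · rw [← sub_le_iff_le_add', le_div_iff₀ hP]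
    linarith [sq_nonneg (P - Q)]

theorem le_max_profile {P Q τ : ℝ} (hP : 0 ≤ P) (hQ : 0 ≤ Q) (h0 : 0 ≤ τ) (h1 : τ ≤ 1) :
    (3 - τ ^ 2) * P + 2 * τ * Q ≤ 3 * max P Q + min P Q ^ 2 / max P Q := by
  rcases (hP.trans (le_max_left P Q)).eq_or_lt with h | h
  · have hP0 : P = 0 := le_antisymm (h ▸ le_max_left P Q) hP
    have hQ0 : Q = 0 := le_antisymm (h ▸ le_max_right P Q) hQ
    simp [hP0, hQ0]
  · rcases le_total Q P with hc | hc
    · rw [max_eq_left hc] at h ⊢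
      rw [min_eq_right hc]
      exact (le_profile_of_le h hc h0 h1).1
    · rw [max_eq_right hc] at h ⊢
      rw [min_eq_left hc]
      exact (le_profile_of_le h hc h0 h1).2

/-- The optimal parameter makes the square in `le_profile_of_le` vanish, so it is `τ = min / max`.
-/
theorem exists_max_profile_eq {P Q : ℝ} (hP : 0 ≤ P) (hQ : 0 ≤ Q) :
    ∃ τ : ℝ, 0 ≤ τ ∧ τ ≤ 1 ∧ (3 * max P Q + min P Q ^ 2 / max P Q
      = (3 - τ ^ 2) * max P Q + 2 * τ * min P Q) := by
  rcases (hP.trans (le_max_left P Q)).eq_or_lt with h | h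
  · refine ⟨0, le_rfl, zero_le_one, ?_⟩
    rw [← h]; simp
  · refine ⟨min P Q / max P Q, div_nonneg (le_min hP hQ) h.le,
      div_le_one_of_le₀ min_le_max h.le, ?_⟩
    field_simp
    ring

/-- A maximum of linear functions with coefficients in `[0, 3]` is Lipschitz: the linear function
that is optimal at `(P, Q)` is a lower bound at `(P', Q')`. -/
theorem max_profile_sub_le {P Q P' Q' : ℝ} (hP : 0 ≤ P) (hQ : 0 ≤ Q) (hP' : 0 ≤ P')
    (hQ' : 0 ≤ Q') :
    (3 * max P Q + min P Q ^ 2 / max P Q) - (3 * max P' Q' + min P' Q' ^ 2 / max P' Q')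
      ≤ 3 * |P - P'| + 3 * |Q - Q'| := by
  obtain ⟨τ, h0, h1, h⟩ := exists_max_profile_eq hP hQ
  have bound : ∀ c y : ℝ, 0 ≤ c → c ≤ 3 → c * y ≤ 3 * |y| := fun c y hc hc3 =>
    (mul_le_mul_of_nonneg_left (le_abs_self y) hc).trans
      (mul_le_mul_of_nonneg_right hc3 (abs_nonneg y))
  rw [h]
  rcases le_total Q P with hc | hc
  · rw [max_eq_left hc, min_eq_right hc]
    have := le_max_profile hP' hQ' h0 h1
    have e1 : (3 - τ ^ 2) * (P - P') ≤ 3 * |P - P'| := bound _ _ (by nlinarith) (by nlinarith)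
    have e2 : 2 * τ * (Q - Q') ≤ 3 * |Q - Q'| := bound _ _ (by nlinarith) (by nlinarith)
    linarith
  · rw [max_eq_right hc, min_eq_left hc]
    have := le_max_profile hQ' hP' h0 h1
    rw [max_comm, min_comm] at this
    have e1 : (3 - τ ^ 2) * (Q - Q') ≤ 3 * |Q - Q'| := bound _ _ (by nlinarith) (by nlinarith)
    have e2 : 2 * τ * (P - P') ≤ 3 * |P - P'| := bound _ _ (by nlinarith) (by nlinarith)
    nlinarith

theorem Phi0_sub_le (x y : R6) : Phi0 x - Phi0 y ≤ 6 * ‖x - y‖ := by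
  have h := max_profile_sub_le (norm_nonneg (pPart x)) (norm_nonneg (qPart x))
    (norm_nonneg (pPart y)) (norm_nonneg (qPart y))
  rw [← Phi0_eq, ← Phi0_eq] at h
  have h1 : |‖pPart x‖ - ‖pPart y‖| ≤ ‖x - y‖ :=
    (abs_norm_sub_norm_le _ _).trans (by rw [← pPart_sub]; exact norm_pPart_le _)
  have h2 : |‖qPart x‖ - ‖qPart y‖| ≤ ‖x - y‖ :=
    (abs_norm_sub_norm_le _ _).trans (by rw [← qPart_sub]; exact norm_qPart_le _)
  have h3 : 1 ≤ 2 * √(2 : ℝ) := by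
    nlinarith [Real.one_le_sqrt.2 (one_le_two (α := ℝ))]
  have h4 : 2 * √2 * (Phi0 x - Phi0 y) ≤ 6 * ‖x - y‖ := by linarith
  by_contra hcon
  push Not at hcon
  nlinarith [norm_nonneg (x - y)]

theorem lipschitzWith_Phi0 : LipschitzWith 6 Phi0 :=
  LipschitzWith.of_dist_le_mul fun x y => by
    rw [Real.dist_eq, dist_eq_norm, abs_le]
    have h1 := Phi0_sub_le x y
    have h2 := Phi0_sub_le y x
    rw [norm_sub_rev] at h2
    constructor <;> · simp only [NNReal.coe_ofNat]; linarith

@[fun_prop] theorem continuous_Phi0 : Continuous Phi0 := lipschitzWith_Phi0.continuous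

/-- The larger of the two norms is positive near `x`, and the smaller one enters only through its
square, so its zeros do no harm. -/
theorem differentiableAt_Phi0 {x : R6} (hx : ‖pPart x‖ ≠ ‖qPart x‖) :
    DifferentiableAt ℝ Phi0 x := by
  have e : Phi0 = fun x : R6 => (3 * max ‖pPart x‖ ‖qPart x‖
      + min ‖pPart x‖ ‖qPart x‖ ^ 2 / max ‖pPart x‖ ‖qPart x‖) / (2 * √2) := by
    funext y; rw [← Phi0_eq]; field_simp
  have hp : DifferentiableAt ℝ pPart x := (contDiff_pPart (n := 1)).differentiable one_ne_zero x
  have hq : DifferentiableAt ℝ qPart x := (contDiff_qPart (n := 1)).differentiable one_ne_zero x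
  rw [e]
  rcases hx.lt_or_gt with h | h
  · have hne : qPart x ≠ 0 := norm_pos_iff.1 ((norm_nonneg _).trans_lt h)
    have hev : (fun x : R6 => (3 * max ‖pPart x‖ ‖qPart x‖
      + min ‖pPart x‖ ‖qPart x‖ ^ 2 / max ‖pPart x‖ ‖qPart x‖) / (2 * √2)) =ᶠ[𝓝 x]
        fun x : R6 => (3 * ‖qPart x‖ + ‖pPart x‖ ^ 2 / ‖qPart x‖) / (2 * √2) := by
      filter_upwards [(isOpen_lt continuous_pPart.norm continuous_qPart.norm).mem_nhds h] with y hy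
      have hy' : ‖pPart y‖ ≤ ‖qPart y‖ := le_of_lt hy
      rw [max_eq_right hy', min_eq_left hy']
    refine DifferentiableAt.congr_of_eventuallyEq ?_ hev
    have h1 : DifferentiableAt ℝ (fun y => ‖qPart y‖) x := hq.norm ℝ hne
    have h2 : DifferentiableAt ℝ (fun y => ‖pPart y‖ ^ 2) x := hp.norm_sq ℝ
    simp only [div_eq_mul_inv]
    exact ((h1.const_mul 3).fun_add (h2.fun_mul (h1.fun_inv (norm_ne_zero_iff.2 hne)))).mul_const _
  · have hne : pPart x ≠ 0 := norm_pos_iff.1 ((norm_nonneg _).trans_lt h)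
    have hev : (fun x : R6 => (3 * max ‖pPart x‖ ‖qPart x‖
      + min ‖pPart x‖ ‖qPart x‖ ^ 2 / max ‖pPart x‖ ‖qPart x‖) / (2 * √2)) =ᶠ[𝓝 x]
        fun x : R6 => (3 * ‖pPart x‖ + ‖qPart x‖ ^ 2 / ‖pPart x‖) / (2 * √2) := by
      filter_upwards [(isOpen_lt continuous_qPart.norm continuous_pPart.norm).mem_nhds h] with y hy
      have hy' : ‖qPart y‖ ≤ ‖pPart y‖ := le_of_lt hy
      rw [max_eq_left hy', min_eq_right hy']
    refine DifferentiableAt.congr_of_eventuallyEq ?_ hev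
    have h1 : DifferentiableAt ℝ (fun y => ‖pPart y‖) x := hp.norm ℝ hne
    have h2 : DifferentiableAt ℝ (fun y => ‖qPart y‖ ^ 2) x := hq.norm_sq ℝ
    simp only [div_eq_mul_inv]
    exact ((h1.const_mul 3).fun_add (h2.fun_mul (h1.fun_inv (norm_ne_zero_iff.2 hne)))).mul_const _

/-! ### A calibration -/

/-- The discriminant of the quadratic equation defining `calibHeight`. -/
noncomputable def calibDisc (w s t : ℝ) : ℝ := √((s - t) ^ 2 + 2 * w * (s + t) + w ^ 2)

/-- The larger root `h` of `(h - s) (h - t) = h w`. -/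
noncomputable def calibHeight (w s t : ℝ) : ℝ := (s + t + w + calibDisc w s t) / 2

/-- The radial coefficient of the calibration. -/
noncomputable def calibCoeff (w s t : ℝ) : ℝ :=
  (3 * √(calibHeight w s t) ^ 2 - t) / √(calibHeight w s t) ^ 3

theorem calibHeight_comm (w s t : ℝ) : calibHeight w s t = calibHeight w t s := by
  simp only [calibHeight, calibDisc]
  rw [add_comm s t, show (s - t) ^ 2 = (t - s) ^ 2 by ring]

theorem calibDisc_comm (w s t : ℝ) : calibDisc w s t = calibDisc w t s := by
  simp only [calibDisc]
  rw [add_comm s t, show (s - t) ^ 2 = (t - s) ^ 2 by ring]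

section

variable {w s t : ℝ}

theorem calib_radicand_pos (hw : 0 < w) (hs : 0 ≤ s) (ht : 0 ≤ t) :
    0 < (s - t) ^ 2 + 2 * w * (s + t) + w ^ 2 := by positivity

theorem calibDisc_pos (hw : 0 < w) (hs : 0 ≤ s) (ht : 0 ≤ t) : 0 < calibDisc w s t :=
  Real.sqrt_pos.2 (calib_radicand_pos hw hs ht)

theorem calibDisc_sq (hw : 0 < w) (hs : 0 ≤ s) (ht : 0 ≤ t) :
    calibDisc w s t ^ 2 = (s - t) ^ 2 + 2 * w * (s + t) + w ^ 2 :=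
  Real.sq_sqrt (calib_radicand_pos hw hs ht).le

theorem abs_sub_le_calibDisc (hw : 0 < w) (hs : 0 ≤ s) (ht : 0 ≤ t) :
    |s - t| ≤ calibDisc w s t := by
  rw [← Real.sqrt_sq_eq_abs]
  refine Real.sqrt_le_sqrt ?_
  have : 0 ≤ 2 * w * (s + t) + w ^ 2 := by positivity
  linarith

theorem left_le_calibHeight (hw : 0 < w) (hs : 0 ≤ s) (ht : 0 ≤ t) : s ≤ calibHeight w s t := by
  have h1 := abs_sub_le_calibDisc hw hs ht
  have h2 := le_abs_self (s - t)
  simp only [calibHeight]; linarith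

theorem right_le_calibHeight (hw : 0 < w) (hs : 0 ≤ s) (ht : 0 ≤ t) : t ≤ calibHeight w s t := by
  rw [calibHeight_comm]; exact left_le_calibHeight hw ht hs

theorem calibHeight_pos (hw : 0 < w) (hs : 0 ≤ s) (ht : 0 ≤ t) : 0 < calibHeight w s t := by
  have := calibDisc_pos hw hs ht
  simp only [calibHeight]; linarith

/-- The height solves `h² - (s + t + w) h + s t = 0`, and the discriminant root is the derivative
`2h - (s + t + w)` of this quadratic at `h`. Multiplying by `h` and using the equation gives the
second identity, which is what cancels the divergence. -/
theorem calibHeight_mul (hw : 0 < w) (hs : 0 ≤ s) (ht : 0 ≤ t) :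
    (2 * calibHeight w s t - (s + t + w)) = calibDisc w s t ∧
    calibHeight w s t ^ 2 - s * t = calibHeight w s t * calibDisc w s t := by
  have h := calibDisc_sq hw hs ht
  constructor
  · simp only [calibHeight]; ring
  · simp only [calibHeight]; linear_combination (-1 / 4) * h

theorem hasDerivAt_sqrt_calibHeight (hw : 0 < w) (hs : 0 ≤ s) (ht : 0 ≤ t) :
    HasDerivAt (fun y => √(calibHeight w y t))
      ((calibHeight w s t - t) / (2 * √(calibHeight w s t) * calibDisc w s t)) s := by
  have h1 : HasDerivAt (fun y => (y - t) ^ 2 + 2 * w * (y + t) + w ^ 2)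
      (2 * (s - t) + 2 * w) s := by
    have := ((((hasDerivAt_id s).sub_const t).fun_pow 2).fun_add
      (((hasDerivAt_id s).add_const t).const_mul (2 * w))).add_const (w ^ 2)
    simpa using this
  have h2 := h1.sqrt (calib_radicand_pos hw hs ht).ne'
  have h3 : HasDerivAt (fun y => calibHeight w y t)
      ((1 + (2 * (s - t) + 2 * w) / (2 * calibDisc w s t)) / 2) s := by
    have := ((((hasDerivAt_id s).add_const t).add_const w).fun_add h2).div_const 2
    simpa [calibHeight, calibDisc] using this
  have h4 := h3.sqrt (calibHeight_pos hw hs ht).ne'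
  convert h4 using 1
  have hd := (calibDisc_pos hw hs ht).ne'
  have hr := (Real.sqrt_pos.2 (calibHeight_pos hw hs ht)).ne'
  have he : calibHeight w s t = (s + t + w + calibDisc w s t) / 2 := rfl
  field_simp
  rw [he]
  ring

/-- The coefficient is `(3h - t) h^(-3/2)`. Its derivative in `h` is `-(3/2)(h - t) h^(-5/2)`, and
`∂h/∂s = (h - t) / calibDisc` contributes the second factor `h - t`. -/
theorem hasDerivAt_calibCoeff (hw : 0 < w) (hs : 0 ≤ s) (ht : 0 ≤ t) :
    HasDerivAt (fun y => calibCoeff w y t)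
      (-(3 / 2) * (calibHeight w s t - t) ^ 2
        / (√(calibHeight w s t) ^ 5 * calibDisc w s t)) s := by
  have h1 := hasDerivAt_sqrt_calibHeight hw hs ht
  have hr := (Real.sqrt_pos.2 (calibHeight_pos hw hs ht)).ne'
  have hd := (calibDisc_pos hw hs ht).ne'
  have h2 := (((h1.fun_pow 2).const_mul 3).sub_const t).fun_div (h1.fun_pow 3) (pow_ne_zero 3 hr)
  have he : calibHeight w s t = √(calibHeight w s t) ^ 2 :=
    (Real.sq_sqrt (calibHeight_pos hw hs ht).le).symm
  refine h2.congr_deriv ?_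
  set r := √(calibHeight w s t)
  rw [he]
  field_simp
  push_cast
  ring

/-- The two sides are the divergences of the `p` block and, up to sign, of the `q` block. Since `s
(h - t)² - t (h - s)² = (s - t)(h² - s t)`, the balance reduces to `h² - s t = h * calibDisc`. -/
theorem calibCoeff_balance (hw : 0 < w) (hs : 0 ≤ s) (ht : 0 ≤ t) :
    3 * calibCoeff w s t + 2 * s * (-(3 / 2) * (calibHeight w s t - t) ^ 2
        / (√(calibHeight w s t) ^ 5 * calibDisc w s t))
      = 3 * calibCoeff w t s + 2 * t * (-(3 / 2) * (calibHeight w t s - s) ^ 2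
        / (√(calibHeight w t s) ^ 5 * calibDisc w t s)) := by
  simp only [calibCoeff, calibHeight_comm w t s, calibDisc_comm w t s]
  have hr := (Real.sqrt_pos.2 (calibHeight_pos hw hs ht)).ne'
  have hd := (calibDisc_pos hw hs ht).ne'
  have he : √(calibHeight w s t) ^ 2 = calibHeight w s t :=
    (Real.sq_sqrt (calibHeight_pos hw hs ht).le)
  have hm := (calibHeight_mul hw hs ht).2
  set r := √(calibHeight w s t)
  set D := calibDisc w s t
  rw [← he] at hm ⊢
  field_simp
  linear_combination (-(s - t)) * hm

end

/-- The calibration: a divergence free vector field. -/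
noncomputable def calib (w : ℝ) (x : R6) : R6 :=
  (2 * √2)⁻¹ • join (calibCoeff w (‖pPart x‖ ^ 2) (‖qPart x‖ ^ 2) • pPart x)
    (-(calibCoeff w (‖qPart x‖ ^ 2) (‖pPart x‖ ^ 2) • qPart x))

theorem contDiff_calibCoeff {E : Type*} [NormedAddCommGroup E] [NormedSpace ℝ E]
    {n : WithTop ℕ∞} {w : ℝ} (hw : 0 < w) {f g : E → ℝ} (hf : ContDiff ℝ n f)
    (hg : ContDiff ℝ n g) (hf0 : ∀ x, 0 ≤ f x) (hg0 : ∀ x, 0 ≤ g x) :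
    ContDiff ℝ n fun x => calibCoeff w (f x) (g x) := by
  have h1 : ContDiff ℝ n fun x => calibDisc w (f x) (g x) := by
    refine ContDiff.sqrt ?_ fun x => (calib_radicand_pos hw (hf0 x) (hg0 x)).ne'
    exact (((hf.sub hg).pow 2).add (contDiff_const.mul (hf.add hg))).add contDiff_const
  have h2 : ContDiff ℝ n fun x => calibHeight w (f x) (g x) :=
    (((hf.add hg).add contDiff_const).add h1).div_const 2
  have h3 : ContDiff ℝ n fun x => √(calibHeight w (f x) (g x)) :=
    h2.sqrt fun x => (calibHeight_pos hw (hf0 x) (hg0 x)).ne'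
  exact ((contDiff_const.mul (h3.pow 2)).sub hg).div (h3.pow 3) fun x =>
    pow_ne_zero 3 (Real.sqrt_pos.2 (calibHeight_pos hw (hf0 x) (hg0 x))).ne'

theorem contDiff_calib {n : WithTop ℕ∞} {w : ℝ} (hw : 0 < w) : ContDiff ℝ n (calib w) := by
  have hp : ContDiff ℝ n fun x : R6 => ‖pPart x‖ ^ 2 := contDiff_pPart.norm_sq ℝ
  have hq : ContDiff ℝ n fun x : R6 => ‖qPart x‖ ^ 2 := contDiff_qPart.norm_sq ℝ
  have h1 := contDiff_calibCoeff hw hp hq (fun _ => sq_nonneg _) (fun _ => sq_nonneg _)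
  have h2 := contDiff_calibCoeff hw hq hp (fun _ => sq_nonneg _) (fun _ => sq_nonneg _)
  exact (contDiff_join.comp ((h1.smul contDiff_pPart).prodMk (h2.smul contDiff_qPart).neg)).const_smul
    (2 * √2)⁻¹

theorem hasDerivAt_line {ι : Type*} [Fintype ι] {X : EuclideanSpace ℝ ι → EuclideanSpace ℝ ι}
    {x : EuclideanSpace ℝ ι} (hX : DifferentiableAt ℝ X x) (v : EuclideanSpace ℝ ι) (i : ι) :
    HasDerivAt (fun τ : ℝ => X (x + τ • v) i) (fderiv ℝ X x v i) 0 := by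
  have hl : HasDerivAt (fun t : ℝ => x + t • v) v 0 := by
    simpa using ((hasDerivAt_id (0 : ℝ)).smul_const v).const_add x
  have h0 : HasFDerivAt X (fderiv ℝ X x) (x + (0 : ℝ) • v) := by
    simpa using hX.hasFDerivAt
  exact (hasDerivAt_pi.1 ((PiLp.hasFDerivAt_ofLp 2 _).comp_hasDerivAt 0
    (h0.comp_hasDerivAt 0 hl))) i

theorem norm_add_smul_single_sq (p : R3) (τ : ℝ) (i : Fin 3) :
    ‖p + τ • EuclideanSpace.single i (1 : ℝ)‖ ^ 2 = ‖p‖ ^ 2 + (2 * p i * τ + τ ^ 2) := by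
  rw [norm_add_sq_real, inner_smul_right, EuclideanSpace.inner_single_right, norm_smul]
  simp
  ring

theorem hasDerivAt_calib_component {w : ℝ} (hw : 0 < w) (p q : R3) (i : Fin 3) :
    HasDerivAt (fun τ : ℝ => calibCoeff w (‖p + τ • EuclideanSpace.single i (1 : ℝ)‖ ^ 2) (‖q‖ ^ 2)
        * (p i + τ))
      (calibCoeff w (‖p‖ ^ 2) (‖q‖ ^ 2) + 2 * p i ^ 2 * (-(3 / 2)
        * (calibHeight w (‖p‖ ^ 2) (‖q‖ ^ 2) - ‖q‖ ^ 2) ^ 2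
        / (√(calibHeight w (‖p‖ ^ 2) (‖q‖ ^ 2)) ^ 5 * calibDisc w (‖p‖ ^ 2) (‖q‖ ^ 2)))) 0 := by
  have h0 := hasDerivAt_calibCoeff hw (sq_nonneg ‖p‖) (sq_nonneg ‖q‖)
  have h1 : HasDerivAt (fun τ : ℝ => ‖p + τ • EuclideanSpace.single i (1 : ℝ)‖ ^ 2)
      (2 * p i) 0 := by
    simp only [norm_add_smul_single_sq]
    have := (((hasDerivAt_id (0 : ℝ)).const_mul (2 * p i)).fun_add
      ((hasDerivAt_id (0 : ℝ)).fun_pow 2)).const_add (‖p‖ ^ 2)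
    simpa using this
  have h3 := (h0.comp_of_eq (0 : ℝ) h1 (by simp)).fun_mul ((hasDerivAt_id (0 : ℝ)).const_add (p i))
  refine h3.congr_deriv ?_
  simp
  ring

/-- In each block the field is a function of `|p|²` and `|q|²` times the position. The three
diagonal derivatives therefore sum to `3F + 2|p|² ∂F`, and similarly for `q`, and the blocks cancel
by `calibCoeff_balance`. -/
theorem divergence_calib {w : ℝ} (hw : 0 < w) (x : R6) : divergence (calib w) x = 0 := by
  have hd : DifferentiableAt ℝ (calib w) x :=
    (contDiff_calib (n := 1) hw).differentiable one_ne_zero x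
  have hl : ∀ i : Fin 3, fderiv ℝ (calib w) x (EuclideanSpace.basisFun _ ℝ (Sum.inl i)) (Sum.inl i)
      = (2 * √2)⁻¹ * (calibCoeff w (‖pPart x‖ ^ 2) (‖qPart x‖ ^ 2) + 2 * pPart x i ^ 2 * (-(3 / 2)
        * (calibHeight w (‖pPart x‖ ^ 2) (‖qPart x‖ ^ 2) - ‖qPart x‖ ^ 2) ^ 2
        / (√(calibHeight w (‖pPart x‖ ^ 2) (‖qPart x‖ ^ 2)) ^ 5
          * calibDisc w (‖pPart x‖ ^ 2) (‖qPart x‖ ^ 2)))) := by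
    intro i
    refine (hasDerivAt_line hd _ _).unique ?_
    have e1 : pPart (EuclideanSpace.basisFun (Fin 3 ⊕ Fin 3) ℝ (Sum.inl i))
        = EuclideanSpace.single i 1 := by
      ext j; simp [pPart]
    have e2 : qPart (EuclideanSpace.basisFun (Fin 3 ⊕ Fin 3) ℝ (Sum.inl i)) = 0 := by
      ext j; simp [qPart]
    have e : (fun τ : ℝ => calib w (x + τ • EuclideanSpace.basisFun _ ℝ (Sum.inl i)) (Sum.inl i))
        = fun τ : ℝ => (2 * √2)⁻¹ * (calibCoeff w
          (‖pPart x + τ • EuclideanSpace.single i (1 : ℝ)‖ ^ 2) (‖qPart x‖ ^ 2) * (pPart x i + τ)) := by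
      funext τ
      simp only [calib, pPart_add, qPart_add, pPart_smul, qPart_smul, e1, e2, smul_zero, add_zero]
      simp [join]
      ring
    rw [e]
    exact (hasDerivAt_calib_component hw (pPart x) (qPart x) i).const_mul _
  have hr : ∀ i : Fin 3, fderiv ℝ (calib w) x (EuclideanSpace.basisFun _ ℝ (Sum.inr i)) (Sum.inr i)
      = -(2 * √2)⁻¹ * (calibCoeff w (‖qPart x‖ ^ 2) (‖pPart x‖ ^ 2) + 2 * qPart x i ^ 2 * (-(3 / 2)
        * (calibHeight w (‖qPart x‖ ^ 2) (‖pPart x‖ ^ 2) - ‖pPart x‖ ^ 2) ^ 2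
        / (√(calibHeight w (‖qPart x‖ ^ 2) (‖pPart x‖ ^ 2)) ^ 5
          * calibDisc w (‖qPart x‖ ^ 2) (‖pPart x‖ ^ 2)))) := by
    intro i
    refine (hasDerivAt_line hd _ _).unique ?_
    have e1 : qPart (EuclideanSpace.basisFun (Fin 3 ⊕ Fin 3) ℝ (Sum.inr i))
        = EuclideanSpace.single i 1 := by
      ext j; simp [qPart]
    have e2 : pPart (EuclideanSpace.basisFun (Fin 3 ⊕ Fin 3) ℝ (Sum.inr i)) = 0 := by
      ext j; simp [pPart]
    have e : (fun τ : ℝ => calib w (x + τ • EuclideanSpace.basisFun _ ℝ (Sum.inr i)) (Sum.inr i))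
        = fun τ : ℝ => -(2 * √2)⁻¹ * (calibCoeff w
          (‖qPart x + τ • EuclideanSpace.single i (1 : ℝ)‖ ^ 2) (‖pPart x‖ ^ 2) * (qPart x i + τ)) := by
      funext τ
      simp only [calib, pPart_add, qPart_add, pPart_smul, qPart_smul, e1, e2, smul_zero, add_zero]
      simp [join]
      ring
    rw [e]
    exact (hasDerivAt_calib_component hw (qPart x) (pPart x) i).const_mul _
  have hb := calibCoeff_balance hw (sq_nonneg ‖pPart x‖) (sq_nonneg ‖qPart x‖)
  have np : ∑ i, pPart x i ^ 2 = ‖pPart x‖ ^ 2 := (EuclideanSpace.real_norm_sq_eq _).symm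
  have nq : ∑ i, qPart x i ^ 2 = ‖qPart x‖ ^ 2 := (EuclideanSpace.real_norm_sq_eq _).symm
  simp only [divergence, Fintype.sum_sum_type, hl, hr, ← Finset.mul_sum, Finset.sum_add_distrib,
    ← Finset.sum_mul, np, nq, Finset.sum_const, Finset.card_univ, Fintype.card_fin, nsmul_eq_mul]
  push_cast
  linear_combination (2 * √2)⁻¹ * hb

/-! ### The calibration inequality and equality in the limit. -/

theorem inner_calib (w : ℝ) (x v : R6) :
    inner ℝ (calib w x) v = (2 * √2)⁻¹ *
      (calibCoeff w (‖pPart x‖ ^ 2) (‖qPart x‖ ^ 2) * inner ℝ (pPart x) (pPart v)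
        - calibCoeff w (‖qPart x‖ ^ 2) (‖pPart x‖ ^ 2) * inner ℝ (qPart x) (qPart v)) := by
  rw [calib, real_inner_smul_left, inner_eq_add, pPart_join, qPart_join, inner_neg_left,
    real_inner_smul_left, real_inner_smul_left]
  ring

/-- The difference of the two sides is `(1 - σ) ((3 - τ²) P - (1 + σ) τ Q)`, and the second factor
is at least `(1 - τ²) P`. -/
theorem profile_le {σ τ P Q : ℝ} (hσ1 : σ ≤ 1) (hτ : 0 ≤ τ) (hτ1 : τ ≤ 1)
    (hQ : 0 ≤ Q) (h : Q ≤ P) :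
    (3 - τ ^ 2) * σ * P + (3 - σ ^ 2) * τ * Q ≤ (3 - τ ^ 2) * P + 2 * τ * Q := by
  have hP := hQ.trans h
  have h1 : (1 + σ) * τ * Q ≤ 2 * 1 * P := by gcongr; linarith
  have h2 : τ ^ 2 ≤ 1 := pow_le_one₀ hτ hτ1
  have h3 : 0 ≤ (1 - τ ^ 2) * P := mul_nonneg (by linarith) hP
  have h4 : 0 ≤ (1 - σ) * ((3 - τ ^ 2) * P - (1 + σ) * τ * Q) :=
    mul_nonneg (by linarith) (by linarith)
  linarith

/-- With `r² = h`, the ratios `σ = |p| / r` and `τ = |q| / r` lie in `[0, 1]` because `h` dominates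
`|p|²` and `|q|²`. Cauchy-Schwarz in each block leaves `(3 - τ²) σ |v_p| + (3 - σ²) τ |v_q|`. The
factor attached to the larger component of `v` can be raised to one, which gives a member of the
linear family whose maximum is `2√2 Φ₀`. -/
theorem inner_calib_le {w : ℝ} (hw : 0 < w) (x v : R6) : inner ℝ (calib w x) v ≤ Phi0 v := by
  have hs := sq_nonneg ‖pPart x‖
  have ht := sq_nonneg ‖qPart x‖
  have hh := calibHeight_pos hw hs ht
  have hr := Real.sqrt_pos.2 hh
  have he : √(calibHeight w (‖pPart x‖ ^ 2) (‖qPart x‖ ^ 2)) ^ 2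
    = calibHeight w (‖pPart x‖ ^ 2) (‖qPart x‖ ^ 2) := Real.sq_sqrt hh.le
  have h1 := left_le_calibHeight hw hs ht
  have h2 := right_le_calibHeight hw hs ht
  have e : 2 * √2 * inner ℝ (calib w x) v =
      calibCoeff w (‖pPart x‖ ^ 2) (‖qPart x‖ ^ 2) * inner ℝ (pPart x) (pPart v)
        - calibCoeff w (‖qPart x‖ ^ 2) (‖pPart x‖ ^ 2) * inner ℝ (qPart x) (qPart v) := by
    rw [inner_calib]; field_simp
  rw [← mul_le_mul_iff_of_pos_left (show 0 < 2 * √(2 : ℝ) by positivity), Phi0_eq, e]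
  simp only [calibCoeff, calibHeight_comm w (‖qPart x‖ ^ 2)]
  set r := √(calibHeight w (‖pPart x‖ ^ 2) (‖qPart x‖ ^ 2))
  rw [← he] at h1 h2
  have hP := norm_nonneg (pPart x)
  have hQ := norm_nonneg (qPart x)
  have h1' : ‖pPart x‖ ≤ r := le_of_sq_le_sq h1 hr.le
  have h2' : ‖qPart x‖ ≤ r := le_of_sq_le_sq h2 hr.le
  have c1 : 0 ≤ (3 * r ^ 2 - ‖qPart x‖ ^ 2) / r ^ 3 :=
    div_nonneg (by nlinarith) (by positivity)
  have c2 : 0 ≤ (3 * r ^ 2 - ‖pPart x‖ ^ 2) / r ^ 3 :=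
    div_nonneg (by nlinarith) (by positivity)
  have i1 := mul_le_mul_of_nonneg_left (real_inner_le_norm (pPart x) (pPart v)) c1
  have i2 := mul_le_mul_of_nonneg_left
    (neg_le.1 (neg_le_of_abs_le (abs_real_inner_le_norm (qPart x) (qPart v)))) c2
  have σ0 := div_nonneg hP hr.le
  have τ0 := div_nonneg hQ hr.le
  have σ1 := div_le_one_of_le₀ h1' hr.le
  have τ1 := div_le_one_of_le₀ h2' hr.le
  have hP' := norm_nonneg (pPart v)
  have hQ' := norm_nonneg (qPart v)
  have main : (3 - (‖qPart x‖ / r) ^ 2) * (‖pPart x‖ / r) * ‖pPart v‖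
      + (3 - (‖pPart x‖ / r) ^ 2) * (‖qPart x‖ / r) * ‖qPart v‖
      ≤ 3 * max ‖pPart v‖ ‖qPart v‖
        + min ‖pPart v‖ ‖qPart v‖ ^ 2 / max ‖pPart v‖ ‖qPart v‖ := by
    rcases le_total ‖qPart v‖ ‖pPart v‖ with h | h
    · exact (profile_le σ1 τ0 τ1 hQ' h).trans (le_max_profile hP' hQ' τ0 τ1)
    · have := (profile_le τ1 σ0 σ1 hP' h).trans (le_max_profile hQ' hP' σ0 σ1)
      rw [max_comm, min_comm] at this
      linarith
  have f1 : (3 * r ^ 2 - ‖qPart x‖ ^ 2) / r ^ 3 * (‖pPart x‖ * ‖pPart v‖)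
      = (3 - (‖qPart x‖ / r) ^ 2) * (‖pPart x‖ / r) * ‖pPart v‖ := by
    field_simp
  have f2 : (3 * r ^ 2 - ‖pPart x‖ ^ 2) / r ^ 3 * (‖qPart x‖ * ‖qPart v‖)
      = (3 - (‖pPart x‖ / r) ^ 2) * (‖qPart x‖ / r) * ‖qPart v‖ := by
    field_simp
  linarith

/-- At `w = 0` the root `√h` becomes `max(|p|, |q|)`, and the pairing with `(p, -q)` reduces to `3
max + min² / max`. The origin is separate: there both sides are zero. -/
theorem tendsto_inner_calib (x : R6) :
    Tendsto (fun w => inner ℝ (calib w x) (gradU x)) (𝓝[>] 0) (𝓝 (Phi0 (gradU x))) := by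
  rcases eq_or_ne x 0 with rfl | hx
  · have h0 : gradU 0 = 0 := by
      rw [← norm_eq_zero, norm_gradU, norm_zero]
    have h1 : Phi0 0 = 0 := by simpa using Phi0_smul 0 0
    simp [h0, h1]
  set P := ‖pPart x‖ with hP
  set Q := ‖qPart x‖ with hQ
  have hM : 0 < max P Q := by
    rcases (norm_nonneg (pPart x)).eq_or_lt with h | h
    · rcases (norm_nonneg (qPart x)).eq_or_lt with h' | h'
      · exfalso; apply hx
        rw [← norm_eq_zero, ← sq_eq_zero_iff, norm_sq_eq_add, ← h, ← h']; simp
      · exact lt_max_of_lt_right h'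
    · exact lt_max_of_lt_left h
  have hr0 : √(calibHeight 0 (P ^ 2) (Q ^ 2)) = max P Q := by
    have : calibHeight 0 (P ^ 2) (Q ^ 2) = max P Q ^ 2 := by
      have e : (P ^ 2 - Q ^ 2) ^ 2 + 2 * 0 * (P ^ 2 + Q ^ 2) + 0 ^ 2 = (P ^ 2 - Q ^ 2) ^ 2 := by
        ring
      rw [calibHeight, calibDisc, e, Real.sqrt_sq_eq_abs]
      rcases le_total Q P with h | h
      · rw [max_eq_left h, abs_of_nonneg (sub_nonneg.2 (pow_le_pow_left₀ (norm_nonneg _) h 2))]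
        ring
      · rw [max_eq_right h, abs_of_nonpos (sub_nonpos.2 (pow_le_pow_left₀ (norm_nonneg _) h 2))]
        ring
    rw [this, Real.sqrt_sq hM.le]
  have hc : Continuous fun w : ℝ => √(calibHeight w (P ^ 2) (Q ^ 2)) := by
    unfold calibHeight calibDisc; fun_prop
  have ht := hc.tendsto 0
  rw [hr0] at ht
  have e : ∀ w, inner ℝ (calib w x) (gradU x) = (2 * √2)⁻¹ *
      ((3 * √(calibHeight w (P ^ 2) (Q ^ 2)) ^ 2 - Q ^ 2)
          / √(calibHeight w (P ^ 2) (Q ^ 2)) ^ 3 * P ^ 2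
        + (3 * √(calibHeight w (P ^ 2) (Q ^ 2)) ^ 2 - P ^ 2)
          / √(calibHeight w (P ^ 2) (Q ^ 2)) ^ 3 * Q ^ 2) := by
    intro w
    rw [inner_calib, pPart_gradU, qPart_gradU, inner_neg_right, real_inner_self_eq_norm_sq,
      real_inner_self_eq_norm_sq, calibCoeff, calibCoeff, calibHeight_comm w (‖qPart x‖ ^ 2)]
    ring
  have hlim : Phi0 (gradU x) = (2 * √2)⁻¹ *
      ((3 * max P Q ^ 2 - Q ^ 2) / max P Q ^ 3 * P ^ 2
        + (3 * max P Q ^ 2 - P ^ 2) / max P Q ^ 3 * Q ^ 2) := by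
    rw [eq_inv_mul_iff_mul_eq₀ (by positivity), Phi0_eq, pPart_gradU, qPart_gradU, norm_neg,
      ← hP, ← hQ]
    rcases le_total Q P with h | h
    · rw [max_eq_left h] at hM ⊢
      rw [min_eq_right h]; field_simp; ring
    · rw [max_eq_right h] at hM ⊢
      rw [min_eq_left h]; field_simp; ring
  simp only [e]
  rw [hlim]
  have h3 := pow_ne_zero 3 hM.ne'
  exact ((((((ht.pow 2).const_mul 3).sub_const _).div (ht.pow 3) h3).mul_const _).add
    (((((ht.pow 2).const_mul 3).sub_const _).div (ht.pow 3) h3).mul_const _)).const_mul _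
      |>.mono_left nhdsWithin_le_nhds

/-! ### The level sets of `quadU` -/

/-- The radius `|p|` of the points `(p, q)` of `{quadU = c}`; zero if there are none. -/
noncomputable def leafRadius (c : ℝ) (q : R3) : ℝ := √(‖q‖ ^ 2 + 2 * c)

/-- The parametrization of `{quadU = c}`. -/
noncomputable def leafMap (c : ℝ) (a : Metric.sphere (0 : R3) 1 × R3) : R6 :=
  join (leafRadius c a.2 • (a.1 : R3)) a.2

/-- The measure on the parameter domain of `leafMap`. -/
noncomputable def leafBase : Measure (Metric.sphere (0 : R3) 1 × R3) :=
  (volume : Measure R3).toSphere.prod volume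

/-- The surface measure of `{quadU = c}`, divided by the norm of the gradient of `quadU`. -/
noncomputable def leafMeasure (c : ℝ) : Measure R6 :=
  (leafBase.withDensity fun a => ENNReal.ofReal (leafRadius c a.2)).map (leafMap c)

theorem leafRadius_nonneg (c : ℝ) (q : R3) : 0 ≤ leafRadius c q := Real.sqrt_nonneg _

@[fun_prop] theorem _root_.Continuous.join {X : Type*} [TopologicalSpace X] {f g : X → R3}
    (hf : Continuous f) (hg : Continuous g) : Continuous fun x => join (f x) (g x) := by
  have h : Continuous fun x => (f x, g x) := hf.prodMk hg
  exact continuous_join.comp h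

@[fun_prop] theorem _root_.Continuous.leafRadius {X : Type*} [TopologicalSpace X] {f : X → ℝ}
    {g : X → R3} (hf : Continuous f) (hg : Continuous g) :
    Continuous fun x => leafRadius (f x) (g x) := by
  unfold ParametricFunctional.leafRadius; fun_prop

@[fun_prop] theorem _root_.Continuous.leafMap {X : Type*} [TopologicalSpace X] {f : X → ℝ}
    {g : X → Metric.sphere (0 : R3) 1 × R3} (hf : Continuous f) (hg : Continuous g) :
    Continuous fun x => leafMap (f x) (g x) := by
  unfold ParametricFunctional.leafMap; fun_prop

theorem continuous_leafMap (c : ℝ) : Continuous (leafMap c) := by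
  change Continuous fun a => leafMap c a
  fun_prop

theorem continuous_leafRadius_snd (c : ℝ) :
    Continuous fun a : Metric.sphere (0 : R3) 1 × R3 => leafRadius c a.2 := by
  fun_prop

theorem norm_pPart_leafMap (c : ℝ) (a : Metric.sphere (0 : R3) 1 × R3) :
    ‖pPart (leafMap c a)‖ = leafRadius c a.2 := by
  have : ‖(a.1 : R3)‖ = 1 := by simp
  rw [leafMap, pPart_join, norm_smul, this, Real.norm_eq_abs, abs_of_nonneg (leafRadius_nonneg _ _),
    mul_one]

@[simp] theorem qPart_leafMap (c : ℝ) (a : Metric.sphere (0 : R3) 1 × R3) :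
    qPart (leafMap c a) = a.2 := qPart_join _ _

theorem leafRadius_sq {c : ℝ} {q : R3} (h : leafRadius c q ≠ 0) :
    leafRadius c q ^ 2 = ‖q‖ ^ 2 + 2 * c := by
  refine Real.sq_sqrt ?_
  by_contra hc
  exact h (Real.sqrt_eq_zero_of_nonpos (not_le.1 hc).le)

theorem quadU_leafMap {c : ℝ} {a : Metric.sphere (0 : R3) 1 × R3} (h : leafRadius c a.2 ≠ 0) :
    quadU (leafMap c a) = c := by
  rw [quadU, norm_pPart_leafMap, qPart_leafMap, leafRadius_sq h]
  ring

instance : IsLocallyFiniteMeasure leafBase := by unfold leafBase; infer_instance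
instance : SFinite leafBase := by
  have : SFinite (volume : Measure R3).toSphere := inferInstance
  have h3 : SFinite (volume : Measure R3) := inferInstance
  unfold leafBase; infer_instance

theorem integral_leafMeasure (c : ℝ) {H : R6 → ℝ} (hH : Continuous H) :
    ∫ x, H x ∂leafMeasure c = ∫ a, leafRadius c a.2 * H (leafMap c a) ∂leafBase := by
  rw [leafMeasure, integral_map (continuous_leafMap c).aemeasurable hH.aestronglyMeasurable,
    integral_withDensity_eq_integral_toReal_smul
      (continuous_leafRadius_snd c).measurable.ennreal_ofReal (by simp)]
  simp only [ENNReal.toReal_ofReal (leafRadius_nonneg _ _), smul_eq_mul]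

instance (c : ℝ) : IsLocallyFiniteMeasure (leafMeasure c) := by
  have : IsFiniteMeasureOnCompacts (leafMeasure c) := by
    refine ⟨fun K hK => ?_⟩
    obtain ⟨R, hR⟩ := hK.isBounded.subset_closedBall 0
    have h1 : IsLocallyFiniteMeasure
        (leafBase.withDensity fun a => ENNReal.ofReal (leafRadius c a.2)) :=
      IsLocallyFiniteMeasure.withDensity_ofReal (continuous_leafRadius_snd c)
    have h2 : IsCompact ((univ : Set (Metric.sphere (0 : R3) 1)) ×ˢ Metric.closedBall (0 : R3) R) :=
      isCompact_univ.prod (isCompact_closedBall _ _)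
    rw [leafMeasure, Measure.map_apply (continuous_leafMap c).measurable hK.measurableSet]
    refine (measure_mono fun a ha => ?_).trans_lt h2.measure_lt_top
    refine ⟨mem_univ _, ?_⟩
    have h3 := hR ha
    rw [mem_closedBall_zero_iff] at h3 ⊢
    rw [← qPart_leafMap c a]
    exact (norm_qPart_le _).trans h3
  infer_instance

/-- Parameters whose image may miss the level set are those with `leafRadius = 0`, and there the
density vanishes. -/
theorem ae_leafMeasure_quadU (c : ℝ) : ∀ᵐ x ∂leafMeasure c, quadU x = c := by
  have hm : MeasurableSet {x : R6 | quadU x = c} :=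
    (isClosed_eq continuous_quadU continuous_const).measurableSet
  rw [leafMeasure, ae_map_iff (continuous_leafMap c).aemeasurable hm,
    ae_withDensity_iff (continuous_leafRadius_snd c).measurable.ennreal_ofReal]
  refine .of_forall fun a ha => quadU_leafMap fun h0 => ha ?_
  simp [h0]

/-! ### The coarea formula for `quadU` -/

theorem measurePreserving_join :
    MeasurePreserving (fun a : R3 × R3 => join a.1 a.2) volume volume := by
  have h1 : MeasurePreserving (fun a : R3 × R3 => (WithLp.ofLp a.1, WithLp.ofLp a.2))
      volume volume :=
    (PiLp.volume_preserving_ofLp (Fin 3)).prod (PiLp.volume_preserving_ofLp (Fin 3))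
  have h2 := volume_measurePreserving_sumPiEquivProdPi_symm (ι := Fin 3) (ι' := Fin 3) fun _ => ℝ
  have h3 := (PiLp.volume_preserving_toLp (Fin 3 ⊕ Fin 3)).comp (h2.comp h1)
  have e : (fun a : R3 × R3 => join a.1 a.2) = WithLp.toLp 2 ∘
      (MeasurableEquiv.sumPiEquivProdPi fun _ : Fin 3 ⊕ Fin 3 => ℝ).symm ∘
      fun a : R3 × R3 => (WithLp.ofLp a.1, WithLp.ofLp a.2) := by
    funext a
    ext i
    rcases i with i | i <;> rfl
  rw [e]
  exact h3

theorem integral_eq_integral_sphere {g : R3 → ℝ} (hg : Integrable g) :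
    ∫ p, g p = ∫ θ : Metric.sphere (0 : R3) 1, ∫ r in Ioi (0 : ℝ), r ^ 2 * g (r • (θ : R3))
      ∂volume ∂(volume : Measure R3).toSphere := by
  have hmp := (volume : Measure R3).measurePreserving_homeomorphUnitSphereProd
  have hd : Module.finrank ℝ R3 - 1 = 2 := by simp
  rw [hd] at hmp
  have hemb := (homeomorphUnitSphereProd R3).measurableEmbedding
  have hG : ∀ x : ({(0 : R3)}ᶜ : Set R3),
      g (((homeomorphUnitSphereProd R3 x).2 : ℝ) • ((homeomorphUnitSphereProd R3 x).1 : R3))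
        = g x := by
    intro x
    have hx : ‖(x : R3)‖ ≠ 0 := norm_ne_zero_iff.2 x.2
    congr 1
    simp [smul_smul, mul_inv_cancel₀ hx]
  have hint : Integrable (fun y : Metric.sphere (0 : R3) 1 × Ioi (0 : ℝ) =>
      g ((y.2 : ℝ) • (y.1 : R3))) ((volume : Measure R3).toSphere.prod (.volumeIoiPow 2)) := by
    rw [← hmp.integrable_comp_emb hemb]
    simp only [Function.comp_def, hG]
    exact (integrableOn_iff_comap_subtypeVal (measurableSet_singleton _).compl).1 hg.integrableOn
  calc
    ∫ p, g p = ∫ x : ({(0 : R3)}ᶜ : Set R3), g x ∂(Measure.comap Subtype.val volume) := by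
      rw [integral_subtype_comap (measurableSet_singleton _).compl g, restrict_compl_singleton]
    _ = ∫ y, g ((y.2 : ℝ) • (y.1 : R3)) ∂((volume : Measure R3).toSphere.prod
        (.volumeIoiPow 2)) := by
      rw [← hmp.integral_comp hemb]
      simp only [hG]
    _ = ∫ θ, ∫ r : Ioi (0 : ℝ), g ((r : ℝ) • (θ : R3)) ∂.volumeIoiPow 2
        ∂(volume : Measure R3).toSphere := integral_prod _ hint
    _ = _ := by
      congr 1
      funext θ
      rw [Measure.volumeIoiPow, integral_withDensity_eq_integral_toReal_smul
        (by fun_prop) (by simp)]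
      rw [integral_subtype_comap measurableSet_Ioi
        fun a : ℝ => (ENNReal.ofReal (a ^ 2)).toReal • g (a • (θ : R3))]
      refine setIntegral_congr_fun measurableSet_Ioi fun r _ => ?_
      simp [ENNReal.toReal_ofReal (sq_nonneg r)]

/-- This is the substitution `s = (r² - |q|²) / 2`, `ds = r dr`; one of the two factors `r` is
absorbed and the other becomes the density of `leafMeasure`. Below `s = -|q|² / 2` the radius is
zero, so the right side may run over all of `ℝ`. -/
theorem integral_Ioi_eq_integral_leafRadius {g : ℝ → ℝ} (hg : Continuous g)
    (hc : HasCompactSupport g) (q : R3) :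
    ∫ r in Ioi (0 : ℝ), r ^ 2 * g r = ∫ s : ℝ, leafRadius s q * g (leafRadius s q) := by
  set f : ℝ → ℝ := fun r => (r ^ 2 - ‖q‖ ^ 2) / 2 with hf
  set G : ℝ → ℝ := fun s => leafRadius s q * g (leafRadius s q) with hG
  have hGc : Continuous G := by
    have : Continuous fun s : ℝ => leafRadius s q := by unfold leafRadius; fun_prop
    fun_prop
  have hfr : ∀ r, 0 ≤ r → leafRadius (f r) q = r := by
    intro r hr
    rw [leafRadius, show ‖q‖ ^ 2 + 2 * f r = r ^ 2 by rw [hf]; ring, Real.sqrt_sq hr]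
  have h0 : ∀ s, s ∉ Ioi (f 0) → G s = 0 := by
    intro s hs
    have : leafRadius s q = 0 := Real.sqrt_eq_zero_of_nonpos (by
      simp only [hf, mem_Ioi, not_lt] at hs; linarith)
    simp [hG, this]
  have hGs : HasCompactSupport G := by
    obtain ⟨R, hR⟩ := hc.isCompact.isBounded.subset_closedBall 0
    refine HasCompactSupport.of_support_subset_isCompact
      (isCompact_Icc (a := f 0) (b := f R)) fun s hs => ?_
    have h1 : leafRadius s q ≠ 0 := fun h => hs (by simp [hG, h])
    have h2 : g (leafRadius s q) ≠ 0 := fun h => hs (by simp [hG, h])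
    have h3 := hR (subset_tsupport _ h2)
    rw [mem_closedBall_zero_iff, Real.norm_eq_abs] at h3
    have h4 := leafRadius_sq h1
    have h5 := sq_le_sq' (neg_le_of_abs_le h3) (le_of_abs_le h3)
    constructor
    · by_contra hlt
      exact hs (h0 s fun h => hlt (le_of_lt h))
    · simp only [hf]; linarith
  have e1 : ∫ r in Ioi (0 : ℝ), r ^ 2 * g r = ∫ r in Ioi (0 : ℝ), (G ∘ f) r * r := by
    refine setIntegral_congr_fun measurableSet_Ioi fun r hr => ?_
    simp only [Function.comp, hG, hfr r (le_of_lt hr)]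
    ring
  rw [e1, integral_comp_mul_deriv_Ioi (f := f) (f' := fun r => r) (g := G)]
  · exact setIntegral_eq_integral_of_forall_compl_eq_zero h0
  · exact Continuous.continuousOn (by fun_prop)
  · have : Tendsto (fun r : ℝ => r ^ 2) atTop atTop := tendsto_pow_atTop two_ne_zero
    exact (tendsto_atTop_add_const_right _ _ this).atTop_div_const two_pos
  · intro r _
    have := (((hasDerivAt_id r).fun_pow 2).sub_const (‖q‖ ^ 2)).div_const 2
    exact (this.congr_deriv (by simp)).hasDerivWithinAt
  · exact hGc.continuousOn
  · exact (hGc.integrable_of_hasCompactSupport hGs).integrableOn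
  · have : Integrable fun r : ℝ => r ^ 2 * g r :=
      Continuous.integrable_of_hasCompactSupport (by fun_prop) hc.mul_left
    refine this.integrableOn.congr_fun (fun r hr => ?_) measurableSet_Ici
    simp only [Function.comp, hG, hfr r hr]
    ring

theorem hasCompactSupport_leaf {G : R6 → ℝ} (hc : HasCompactSupport G) :
    HasCompactSupport fun z : ℝ × (Metric.sphere (0 : R3) 1 × R3) =>
      leafRadius z.1 z.2.2 * G (leafMap z.1 z.2) := by
  obtain ⟨R, hR⟩ := hc.isCompact.isBounded.subset_closedBall 0
  refine HasCompactSupport.of_support_subset_isCompact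
    ((isCompact_Icc (a := -R ^ 2) (b := R ^ 2)).prod
      (isCompact_univ.prod (isCompact_closedBall (0 : R3) R))) fun z hz => ?_
  have h1 : leafRadius z.1 z.2.2 ≠ 0 := fun h => hz (by simp [h])
  have h2 : G (leafMap z.1 z.2) ≠ 0 := fun h => hz (by simp [h])
  have h3 := hR (subset_tsupport _ h2)
  rw [mem_closedBall_zero_iff] at h3
  have h4 := (norm_pPart_le _).trans h3
  have h5 := (norm_qPart_le _).trans h3
  rw [norm_pPart_leafMap] at h4
  rw [qPart_leafMap] at h5
  have h6 := leafRadius_sq h1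
  have h7 := pow_le_pow_left₀ (leafRadius_nonneg z.1 z.2.2) h4 2
  have h8 := pow_le_pow_left₀ (norm_nonneg z.2.2) h5 2
  refine ⟨⟨?_, ?_⟩, mem_univ _, mem_closedBall_zero_iff.2 h5⟩
  · nlinarith [sq_nonneg (leafRadius z.1 z.2.2), sq_nonneg R]
  · nlinarith [sq_nonneg ‖z.2.2‖, sq_nonneg R]

theorem continuous_leaf {G : R6 → ℝ} (hG : Continuous G) :
    Continuous fun z : ℝ × (Metric.sphere (0 : R3) 1 × R3) =>
      leafRadius z.1 z.2.2 * G (leafMap z.1 z.2) := by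
  fun_prop

/-- The coarea formula for `quadU`. -/
theorem integral_eq_integral_leafMeasure {G : R6 → ℝ} (hG : Continuous G)
    (hc : HasCompactSupport G) : ∫ x, G x = ∫ s, ∫ x, G x ∂leafMeasure s := by
  have hemb : MeasurableEmbedding fun a : R3 × R3 => join a.1 a.2 := by
    refine continuous_join.measurableEmbedding fun a b h => ?_
    have h1 := congrArg pPart h
    have h2 := congrArg qPart h
    simp only [pPart_join, qPart_join] at h1 h2
    exact Prod.ext h1 h2
  have hI : Integrable fun a : R3 × R3 => G (join a.1 a.2) :=
    (measurePreserving_join.integrable_comp_emb hemb).2 (hG.integrable_of_hasCompactSupport hc)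
  have hF := (continuous_leaf hG).integrable_of_hasCompactSupport
    (μ := (volume : Measure ℝ).prod leafBase) (hasCompactSupport_leaf hc)
  have hsec : ∀ q : R3, ∫ p, G (join p q) = ∫ θ : Metric.sphere (0 : R3) 1,
      ∫ s : ℝ, leafRadius s q * G (leafMap s (θ, q)) ∂volume ∂(volume : Measure R3).toSphere := by
    intro q
    obtain ⟨R, hR⟩ := hc.isCompact.isBounded.subset_closedBall 0
    have hq : Continuous fun p : R3 => G (join p q) := by fun_prop
    have hqc : HasCompactSupport fun p : R3 => G (join p q) := by
      refine HasCompactSupport.of_support_subset_isCompact (isCompact_closedBall (0 : R3) R)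
        fun p hp => ?_
      have h3 := hR (subset_tsupport _ hp)
      rw [mem_closedBall_zero_iff] at h3 ⊢
      simpa using (norm_pPart_le _).trans h3
    rw [integral_eq_integral_sphere (hq.integrable_of_hasCompactSupport hqc)]
    congr 1
    funext θ
    have hθ : ‖(θ : R3)‖ = 1 := by simp
    refine integral_Ioi_eq_integral_leafRadius (g := fun r => G (join (r • (θ : R3)) q))
      (by fun_prop) ?_ q
    refine HasCompactSupport.of_support_subset_isCompact (isCompact_closedBall (0 : ℝ) R)
      fun r hr => ?_
    have h3 := hR (subset_tsupport _ hr)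
    rw [mem_closedBall_zero_iff] at h3 ⊢
    simpa [norm_smul, hθ] using (norm_pPart_le _).trans h3
  calc
    ∫ x, G x = ∫ a : R3 × R3, G (join a.1 a.2) := (measurePreserving_join.integral_comp hemb G).symm
    _ = ∫ q, ∫ p, G (join p q) := integral_prod_symm _ hI
    _ = ∫ q, ∫ θ : Metric.sphere (0 : R3) 1, ∫ s : ℝ, leafRadius s q * G (leafMap s (θ, q))
          ∂volume ∂(volume : Measure R3).toSphere := by simp only [hsec]
    _ = ∫ a, ∫ s : ℝ, leafRadius s a.2 * G (leafMap s a) ∂volume ∂leafBase :=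
      (integral_prod_symm _ hF.integral_prod_right).symm
    _ = ∫ s, ∫ a, leafRadius s a.2 * G (leafMap s a) ∂leafBase := (integral_integral_swap hF).symm
    _ = _ := by simp only [integral_leafMeasure _ hG]

/-- The support of `H` confines `q` to a ball that does not depend on `s`, so the integral is over a
fixed compact set of parameters. -/
theorem continuous_integral_leafMeasure {H : R6 → ℝ} (hH : Continuous H)
    (hc : HasCompactSupport H) : Continuous fun s => ∫ x, H x ∂leafMeasure s := by
  obtain ⟨R, hR⟩ := hc.isCompact.isBounded.subset_closedBall 0
  have h2 : IsCompact ((univ : Set (Metric.sphere (0 : R3) 1)) ×ˢ Metric.closedBall (0 : R3) R) :=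
    isCompact_univ.prod (isCompact_closedBall _ _)
  have h := continuous_parametric_integral_of_continuous (μ := leafBase) (f := fun s a =>
    leafRadius s a.2 * H (leafMap s a)) (continuous_leaf hH) h2
  convert h using 2 with s
  rw [integral_leafMeasure s hH, setIntegral_eq_integral_of_forall_compl_eq_zero]
  intro a ha
  rw [image_eq_zero_of_notMem_tsupport (f := H), mul_zero]
  intro hmem
  have h3 := (norm_qPart_le _).trans (mem_closedBall_zero_iff.1 (hR hmem))
  rw [qPart_leafMap] at h3
  exact ha ⟨mem_univ _, mem_closedBall_zero_iff.2 h3⟩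

/-! ### The divergence theorem on the sublevel sets of `quadU` -/

section Divergence

variable {ι : Type*} [Fintype ι]

theorem continuous_divergence {X : EuclideanSpace ℝ ι → EuclideanSpace ℝ ι}
    (hX : ContDiff ℝ 1 X) : Continuous (divergence X) := by
  have h := hX.continuous_fderiv one_ne_zero
  unfold divergence
  fun_prop

theorem hasCompactSupport_divergence {X : EuclideanSpace ℝ ι → EuclideanSpace ℝ ι}
    (hX : HasCompactSupport X) : HasCompactSupport (divergence X) := by
  refine (hX.fderiv ℝ).mono fun x hx h => hx ?_
  simp [divergence, h]

theorem apply_eq_sum (L : EuclideanSpace ℝ ι →L[ℝ] ℝ) (v : EuclideanSpace ℝ ι) :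
    L v = ∑ i, v i * L (EuclideanSpace.basisFun ι ℝ i) := by
  conv_lhs => rw [← (EuclideanSpace.basisFun ι ℝ).sum_repr v]
  simp [map_sum]

theorem fderiv_component {X : EuclideanSpace ℝ ι → EuclideanSpace ℝ ι}
    {x : EuclideanSpace ℝ ι} (hX : DifferentiableAt ℝ X x) (v : EuclideanSpace ℝ ι) (i : ι) :
    fderiv ℝ (fun y => X y i) x v = fderiv ℝ X x v i := by
  have h : HasFDerivAt (fun y => X y i)
      ((EuclideanSpace.proj i : EuclideanSpace ℝ ι →L[ℝ] ℝ).comp (fderiv ℝ X x)) x :=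
    (EuclideanSpace.proj i : EuclideanSpace ℝ ι →L[ℝ] ℝ).hasFDerivAt.comp x hX.hasFDerivAt
  rw [h.fderiv]
  rfl

/-- Integration by parts. -/
theorem integral_mul_divergence {X : EuclideanSpace ℝ ι → EuclideanSpace ℝ ι}
    {η : EuclideanSpace ℝ ι → ℝ} (hX : ContDiff ℝ 1 X) (hc : HasCompactSupport X)
    (hη : ContDiff ℝ 1 η) :
    ∫ x, η x * divergence X x = -∫ x, fderiv ℝ η x (X x) := by
  have hXi : ∀ i, ContDiff ℝ 1 fun x => X x i := fun i => contDiff_euclidean.1 hX i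
  have hci : ∀ i, HasCompactSupport fun x => X x i := fun i =>
    hc.comp_left (g := fun v : EuclideanSpace ℝ ι => v i) rfl
  have hηc := hη.continuous_fderiv one_ne_zero
  have hXc : ∀ i, Continuous (fderiv ℝ fun x => X x i) := fun i =>
    (hXi i).continuous_fderiv one_ne_zero
  have hcont := hη.continuous
  have hconti := fun i => (hXi i).continuous
  have hXd : ∀ x, DifferentiableAt ℝ X x := hX.differentiable one_ne_zero
  have I1 : ∀ i, Integrable fun x => fderiv ℝ η x (EuclideanSpace.basisFun ι ℝ i) * X x i := fun i =>
    Continuous.integrable_of_hasCompactSupport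
      ((hηc.clm_apply continuous_const).mul (hconti i)) (hci i).mul_left
  have I2 : ∀ i, Integrable fun x => η x *
      fderiv ℝ (fun x => X x i) x (EuclideanSpace.basisFun ι ℝ i) := fun i =>
    Continuous.integrable_of_hasCompactSupport
      (hcont.mul ((hXc i).clm_apply continuous_const)) (((hci i).fderiv_apply ℝ _).mul_left)
  have I3 : ∀ i, Integrable fun x => η x * X x i := fun i =>
    Continuous.integrable_of_hasCompactSupport (hcont.mul (hconti i)) (hci i).mul_left
  have e1 : ∀ x, η x * divergence X x = ∑ i, η x *
      fderiv ℝ (fun x => X x i) x (EuclideanSpace.basisFun ι ℝ i) := by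
    intro x
    simp only [divergence, Finset.mul_sum, fderiv_component (hXd x)]
  have e2 : ∀ x, fderiv ℝ η x (X x)
      = ∑ i, fderiv ℝ η x (EuclideanSpace.basisFun ι ℝ i) * X x i := by
    intro x
    rw [apply_eq_sum]
    simp only [mul_comm]
  simp only [e1, e2]
  rw [integral_finsetSum _ fun i _ => I2 i, integral_finsetSum _ fun i _ => I1 i,
    ← Finset.sum_neg_distrib]
  refine Finset.sum_congr rfl fun i _ => ?_
  exact integral_mul_fderiv_eq_neg_fderiv_mul_of_integrable (I1 i) (I2 i) (I3 i)
    (fun x _ => hη.differentiable one_ne_zero x) (fun x _ => (hXi i).differentiable one_ne_zero x)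

end Divergence

/-! ### Smooth approximation of the indicator function of a sublevel set. -/

/-- A smooth decreasing function, equal to `1` on `(-∞, -1]` and to `0` on `[0, ∞)`. -/
noncomputable def step (τ : ℝ) : ℝ := 1 - Real.smoothTransition (τ + 1)

theorem contDiff_step : ContDiff ℝ 1 step :=
  contDiff_const.sub (Real.smoothTransition.contDiff.comp (contDiff_id.add contDiff_const))

theorem step_of_le {τ : ℝ} (h : τ ≤ -1) : step τ = 1 := by
  rw [step, Real.smoothTransition.zero_of_nonpos (by linarith), sub_zero]

theorem step_of_nonneg {τ : ℝ} (h : 0 ≤ τ) : step τ = 0 := by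
  rw [step, Real.smoothTransition.one_of_one_le (by linarith), sub_self]

theorem abs_step_le (τ : ℝ) : |step τ| ≤ 1 := by
  have h1 := Real.smoothTransition.nonneg (τ + 1)
  have h2 := Real.smoothTransition.le_one (τ + 1)
  rw [step, abs_le]
  constructor <;> linarith

theorem continuous_deriv_step : Continuous (deriv step) :=
  contDiff_step.continuous_deriv le_rfl

theorem deriv_step_of_notMem {τ : ℝ} (h : τ ∉ Icc (-1 : ℝ) 0) : deriv step τ = 0 := by
  rw [mem_Icc, not_and_or, not_le, not_le] at h
  rcases h with h | h
  · have : step =ᶠ[𝓝 τ] fun _ => 1 := by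
      filter_upwards [Iio_mem_nhds h] with y hy using step_of_le (le_of_lt hy)
    rw [this.deriv_eq]; simp
  · have : step =ᶠ[𝓝 τ] fun _ => 0 := by
      filter_upwards [Ioi_mem_nhds h] with y hy using step_of_nonneg (le_of_lt hy)
    rw [this.deriv_eq]; simp

theorem hasCompactSupport_deriv_step : HasCompactSupport (deriv step) :=
  HasCompactSupport.of_support_subset_isCompact (isCompact_Icc (a := -1) (b := 0)) fun _ h => by
    by_contra hc
    exact h (deriv_step_of_notMem hc)

theorem integral_deriv_step : ∫ τ, deriv step τ = -1 := by
  have h := integral_of_hasDerivAt_of_tendsto (f := step) (f' := deriv step) (m := 1) (n := 0)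
    (fun x => (contDiff_step.differentiable one_ne_zero x).hasDerivAt)
    (continuous_deriv_step.integrable_of_hasCompactSupport hasCompactSupport_deriv_step)
    (tendsto_const_nhds.congr' (by
      filter_upwards [Iic_mem_atBot (-1 : ℝ)] with τ hτ using (step_of_le hτ).symm))
    (tendsto_const_nhds.congr' (by
      filter_upwards [Ici_mem_atTop (0 : ℝ)] with τ hτ using (step_of_nonneg hτ).symm))
  rw [h]; norm_num

theorem integral_deriv_step_comp {K : ℝ → ℝ} (c : ℝ) {a : ℝ} (ha : 0 < a) :
    ∫ s, a * deriv step (a * (s - c)) * K s = ∫ τ, deriv step τ * K (c + τ / a) := by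
  have h1 : ∀ s, a * deriv step (a * (s - c)) * K s
      = a * (fun τ => deriv step τ * K (c + τ / a)) (a * (s - c)) := by
    intro s
    simp only [mul_div_cancel_left₀ _ ha.ne', add_sub_cancel]
    ring
  simp only [h1]
  rw [integral_const_mul, integral_sub_right_eq_self
    (fun s => (fun τ => deriv step τ * K (c + τ / a)) (a * s)) c,
    Measure.integral_comp_mul_left (fun τ => deriv step τ * K (c + τ / a)) a,
    abs_of_pos (inv_pos.2 ha), smul_eq_mul, mul_inv_cancel_left₀ ha.ne']

/-- The rescaled derivatives of `step` have total mass `-1` and concentrate at `c`. Since `τ ∈ [-1,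
0]`, only values of `K` within distance one of `c` enter, which provides the dominating constant. -/
theorem tendsto_integral_deriv_step {K : ℝ → ℝ} (hK : Continuous K) (c : ℝ) :
    Tendsto (fun n : ℕ => ∫ τ, deriv step τ * K (c + τ / (n + 1 : ℝ))) atTop (𝓝 (-K c)) := by
  obtain ⟨M, hM⟩ := (isCompact_closedBall c 1).exists_bound_of_continuousOn hK.continuousOn
  have hlim : -K c = ∫ τ, deriv step τ * K c := by
    rw [integral_mul_const, integral_deriv_step]; ring
  rw [hlim]
  refine tendsto_integral_of_dominated_convergence (fun τ => ‖deriv step τ‖ * M) (fun n => ?_)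
    ?_ (fun n => .of_forall fun τ => ?_) (.of_forall fun τ => ?_)
  · exact (continuous_deriv_step.mul (hK.comp (by fun_prop))).aestronglyMeasurable
  · exact (continuous_deriv_step.integrable_of_hasCompactSupport
      hasCompactSupport_deriv_step).norm.mul_const M
  · rw [norm_mul]
    by_cases hτ : τ ∈ Icc (-1 : ℝ) 0
    · refine mul_le_mul_of_nonneg_left (hM _ ?_) (norm_nonneg _)
      have hn : (1 : ℝ) ≤ n + 1 := by simp
      rw [Metric.mem_closedBall, Real.dist_eq, add_sub_cancel_left, abs_div,
        abs_of_pos (by linarith : (0 : ℝ) < n + 1)]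
      refine div_le_one_of_le₀ ((abs_le.2 ⟨?_, ?_⟩).trans hn) (by linarith)
      · exact hτ.1
      · exact hτ.2.trans zero_le_one
    · simp [deriv_step_of_notMem hτ]
  · refine tendsto_const_nhds.mul ((hK.tendsto c).comp ?_)
    have h1 : Tendsto (fun n : ℕ => (n + 1 : ℝ)) atTop atTop :=
      tendsto_atTop_add_const_right _ _ tendsto_natCast_atTop_atTop
    simpa using (h1.const_div_atTop τ).const_add c

/-- If `H` is, in the sense of distributions, the flux of a field with divergence `D` through the
level sets of `quadU`, then the Gauss-Green formula holds on the sublevel sets. -/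
theorem integral_sublevel {D H : R6 → ℝ} (hD : Continuous D) (hDc : HasCompactSupport D)
    (hH : Continuous H) (hHc : HasCompactSupport H)
    (h : ∀ χ : ℝ → ℝ, ContDiff ℝ 1 χ →
      ∫ x, χ (quadU x) * D x = -∫ x, deriv χ (quadU x) * H x) (c : ℝ) :
    ∫ x in {x | quadU x < c}, D x = ∫ x, H x ∂leafMeasure c := by
  have hDi := hD.integrable_of_hasCompactSupport hDc (μ := volume)
  have hmeas : MeasurableSet {x : R6 | quadU x < c} :=
    (isOpen_lt continuous_quadU continuous_const).measurableSet
  have hpos : ∀ n : ℕ, (0 : ℝ) < n + 1 := fun n => by positivity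
  have hχ : ∀ n : ℕ, ContDiff ℝ 1 fun s => step ((n + 1 : ℝ) * (s - c)) := fun n =>
    contDiff_step.comp (contDiff_const.mul (contDiff_id.sub contDiff_const))
  have hχ' : ∀ (n : ℕ) (s : ℝ), deriv (fun s => step ((n + 1 : ℝ) * (s - c))) s
      = (n + 1) * deriv step ((n + 1) * (s - c)) := by
    intro n s
    have h1 : HasDerivAt step (deriv step ((n + 1 : ℝ) * (s - c))) ((n + 1 : ℝ) * (s - c)) :=
      (contDiff_step.differentiable one_ne_zero _).hasDerivAt
    have h2 : HasDerivAt (fun s : ℝ => (n + 1 : ℝ) * (s - c)) (n + 1) s := by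
      simpa using ((hasDerivAt_id s).sub_const c).const_mul (n + 1 : ℝ)
    have := (h1.comp s h2).deriv
    rw [mul_comm]
    exact this
  have hL : Tendsto (fun n : ℕ => ∫ x, step ((n + 1 : ℝ) * (quadU x - c)) * D x) atTop
      (𝓝 (∫ x in {x | quadU x < c}, D x)) := by
    rw [← integral_indicator hmeas]
    refine tendsto_integral_of_dominated_convergence (fun x => ‖D x‖) (fun n => ?_)
      hDi.norm (fun n => .of_forall fun x => ?_) (.of_forall fun x => ?_)
    · have := contDiff_step.continuous
      exact Continuous.aestronglyMeasurable (by fun_prop)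
    · rw [norm_mul]
      exact mul_le_of_le_one_left (norm_nonneg _) (abs_step_le _)
    · by_cases hx : quadU x < c
      · rw [indicator_of_mem (by exact hx)]
        have h1 : Tendsto (fun n : ℕ => (n + 1 : ℝ) * (quadU x - c)) atTop atBot :=
          (tendsto_atTop_add_const_right _ _ tendsto_natCast_atTop_atTop).atTop_mul_const_of_neg
            (sub_neg.2 hx)
        refine tendsto_const_nhds.congr' ?_
        filter_upwards [h1.eventually_le_atBot (-1)] with n hn
        rw [step_of_le hn, one_mul]
      · rw [indicator_of_notMem (by exact hx)]
        refine tendsto_const_nhds.congr fun n => ?_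
        rw [step_of_nonneg (mul_nonneg (hpos n).le (sub_nonneg.2 (not_lt.1 hx))), zero_mul]
  -- By coarea the right side of `h` is an integral over levels `s`, on each of which the factor
  -- `deriv χ (quadU x)` is constant.
  have hR : ∀ n : ℕ, ∫ x, step ((n + 1 : ℝ) * (quadU x - c)) * D x
      = -∫ τ, deriv step τ * ∫ x, H x ∂leafMeasure (c + τ / (n + 1 : ℝ)) := by
    intro n
    rw [h _ (hχ n), ← integral_deriv_step_comp (K := fun s => ∫ x, H x ∂leafMeasure s) c (hpos n)]
    simp only [hχ']
    rw [integral_eq_integral_leafMeasure]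
    · congr 2
      funext s
      rw [← integral_const_mul]
      refine integral_congr_ae ?_
      filter_upwards [ae_leafMeasure_quadU s] with x hx
      rw [hx]
    · have := continuous_deriv_step
      fun_prop
    · exact hHc.mul_left
  simp only [hR] at hL
  have hlim := (tendsto_integral_deriv_step (continuous_integral_leafMeasure hH hHc) c).neg
  rw [neg_neg] at hlim
  exact tendsto_nhds_unique hL hlim

/-! ### Diffeomorphic images of the sublevel sets of `quadU` -/

/-- `φ` and `ψ` are mutually inverse `C¹` diffeomorphisms of `ℝ⁶`. -/
structure IsDiffeo (φ ψ : R6 → R6) : Prop where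
  contDiff : ContDiff ℝ 1 φ
  contDiff_inv : ContDiff ℝ 1 ψ
  left_inv : ∀ x, ψ (φ x) = x
  right_inv : ∀ x, φ (ψ x) = x

theorem isDiffeo_id : IsDiffeo id id :=
  ⟨contDiff_id, contDiff_id, fun _ => rfl, fun _ => rfl⟩

/-- The normal to the image of a level set of `quadU` under `φ`, pulled back by `φ`. -/
noncomputable def pullbackNormal (φ ψ : R6 → R6) (x : R6) : R6 :=
  |(fderiv ℝ φ x).det| • ContinuousLinearMap.adjoint (fderiv ℝ ψ (φ x)) (gradU x)

theorem pullbackNormal_id (x : R6) : pullbackNormal id id x = gradU x := by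
  have h : ContinuousLinearMap.adjoint (ContinuousLinearMap.id ℝ R6)
      = ContinuousLinearMap.id ℝ R6 := ContinuousLinearMap.adjoint_id
  simp [pullbackNormal, h, ContinuousLinearMap.det]

/-- The area measure of the image under `φ` of a level set of `quadU`. -/
noncomputable def imageMeasure (φ ψ : R6 → R6) (c : ℝ) : Measure R6 :=
  ((leafMeasure c).withDensity fun x => ENNReal.ofReal ‖pullbackNormal φ ψ x‖).map φ

/-- The unit normal of the image under `φ` of a level set of `quadU`. -/
noncomputable def imageNormal (φ ψ : R6 → R6) (y : R6) : R6 :=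
  ‖pullbackNormal φ ψ (ψ y)‖⁻¹ • pullbackNormal φ ψ (ψ y)

namespace IsDiffeo

variable {φ ψ : R6 → R6}

/-- The homeomorphism underlying a diffeomorphism. -/
def homeomorph (h : IsDiffeo φ ψ) : R6 ≃ₜ R6 where
  toFun := φ
  invFun := ψ
  left_inv := h.left_inv
  right_inv := h.right_inv
  continuous_toFun := h.contDiff.continuous
  continuous_invFun := h.contDiff_inv.continuous

theorem measurableEmbedding (h : IsDiffeo φ ψ) : MeasurableEmbedding φ :=
  h.homeomorph.measurableEmbedding

theorem injective (h : IsDiffeo φ ψ) : Function.Injective φ := h.homeomorph.injective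

theorem continuous_pullbackNormal (h : IsDiffeo φ ψ) : Continuous (pullbackNormal φ ψ) := by
  have h1 : Continuous fun x => (fderiv ℝ φ x).det :=
    ContinuousLinearMap.continuous_det.comp (h.contDiff.continuous_fderiv one_ne_zero)
  have h2 : Continuous fun x => fderiv ℝ ψ (φ x) :=
    (h.contDiff_inv.continuous_fderiv one_ne_zero).comp h.contDiff.continuous
  have h3 : Continuous fun x => ContinuousLinearMap.adjoint (fderiv ℝ ψ (φ x)) :=
    ContinuousLinearMap.adjoint.continuous.comp h2
  exact h1.abs.smul (h3.clm_apply continuous_gradU)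

/-- Chain rule for `u ∘ ψ`, the defining function of the image. The determinant is the Jacobian of
the change of variables `y = φ x`, so that the flux can be integrated against the undeformed
`leafMeasure`. -/
theorem hasFDerivAt_quadU_comp (h : IsDiffeo φ ψ) (x v : R6) :
    |(fderiv ℝ φ x).det| * fderiv ℝ (fun y => quadU (ψ y)) (φ x) v
      = inner ℝ v (pullbackNormal φ ψ x) := by
  have h1 : HasFDerivAt ψ (fderiv ℝ ψ (φ x)) (φ x) :=
    (h.contDiff_inv.differentiable one_ne_zero _).hasFDerivAt
  have h2 := hasFDerivAt_quadU (ψ (φ x))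
  have h3 : fderiv ℝ (fun y => quadU (ψ y)) (φ x)
      = (innerSL ℝ (gradU (ψ (φ x)))).comp (fderiv ℝ ψ (φ x)) := (h2.comp (φ x) h1).fderiv
  rw [h3, h.left_inv, pullbackNormal, inner_smul_right, ContinuousLinearMap.adjoint_inner_right,
    real_inner_comm]
  rfl

theorem integral_comp (h : IsDiffeo φ ψ) (f : R6 → ℝ) (s : Set R6) (hs : MeasurableSet s) :
    ∫ y in φ '' s, f y = ∫ x in s, |(fderiv ℝ φ x).det| * f (φ x) := by
  have := integral_image_eq_integral_abs_det_fderiv_smul volume hs (f := φ)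
    (fun x _ => (h.contDiff.differentiable one_ne_zero x).hasFDerivAt.hasFDerivWithinAt)
    h.injective.injOn f
  simpa using this

/-- The Gauss-Green formula for the image of a sublevel set of `quadU`. -/
theorem integral_divergence (h : IsDiffeo φ ψ) (c : ℝ) {X : R6 → R6} (hX : ContDiff ℝ 1 X)
    (hc : HasCompactSupport X) :
    ∫ y in φ '' {x | quadU x < c}, divergence X y
      = ∫ x, inner ℝ (X (φ x)) (pullbackNormal φ ψ x) ∂leafMeasure c := by
  have hmeas : MeasurableSet {x : R6 | quadU x < c} :=
    (isOpen_lt continuous_quadU continuous_const).measurableSet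
  have hφ := h.contDiff.continuous
  have hdet : Continuous fun x => (fderiv ℝ φ x).det :=
    ContinuousLinearMap.continuous_det.comp (h.contDiff.continuous_fderiv one_ne_zero)
  have hdiv := continuous_divergence hX
  have hdc : HasCompactSupport fun x => divergence X (φ x) :=
    (hasCompactSupport_divergence hc).comp_homeomorph h.homeomorph
  have hXc : HasCompactSupport fun x => X (φ x) := hc.comp_homeomorph h.homeomorph
  have hXcont := hX.continuous
  have hN := h.continuous_pullbackNormal
  rw [h.integral_comp _ _ hmeas]
  refine integral_sublevel (D := fun x => |(fderiv ℝ φ x).det| * divergence X (φ x))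
    (H := fun x => inner ℝ (X (φ x)) (pullbackNormal φ ψ x))
    (by fun_prop) hdc.mul_left (by fun_prop) ?_ (fun χ hχ => ?_) c
  · exact hXc.mono fun x hx h0 => hx (by simp [h0])
  -- Integration by parts is done on the image side with test function `χ ∘ u ∘ ψ`, and only
  -- afterwards pulled back. This needs no second derivatives of `φ`.
  · have hu : ContDiff ℝ 1 fun y => quadU (ψ y) := contDiff_quadU.comp h.contDiff_inv
    have hη : ContDiff ℝ 1 fun y => χ (quadU (ψ y)) := hχ.comp hu
    have hfd : ∀ y v, fderiv ℝ (fun y => χ (quadU (ψ y))) y v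
        = deriv χ (quadU (ψ y)) * fderiv ℝ (fun y => quadU (ψ y)) y v := by
      intro y v
      have h1 : HasDerivAt χ (deriv χ (quadU (ψ y))) (quadU (ψ y)) :=
        (hχ.differentiable one_ne_zero _).hasDerivAt
      have h2 : HasFDerivAt (fun y => quadU (ψ y)) (fderiv ℝ (fun y => quadU (ψ y)) y) y :=
        (hu.differentiable one_ne_zero y).hasFDerivAt
      have h3 : fderiv ℝ (fun y => χ (quadU (ψ y))) y
          = deriv χ (quadU (ψ y)) • fderiv ℝ (fun y => quadU (ψ y)) y :=
        (h1.comp_hasFDerivAt y h2).fderiv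
      rw [h3]; rfl
    have huniv : φ '' univ = univ := image_univ_of_surjective h.homeomorph.surjective
    have e1 := h.integral_comp (fun y => χ (quadU (ψ y)) * divergence X y) univ .univ
    have e2 := h.integral_comp (fun y => fderiv ℝ (fun y => χ (quadU (ψ y))) y (X y)) univ .univ
    rw [huniv, setIntegral_univ, setIntegral_univ] at e1 e2
    have e3 := integral_mul_divergence hX hc hη
    rw [e1, e2] at e3
    simp only [h.left_inv, hfd] at e3
    convert e3 using 1
    · congr 1; funext x; ring
    · congr 2; funext x
      rw [← h.hasFDerivAt_quadU_comp]; ring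

theorem isLocallyFiniteMeasure_imageMeasure (h : IsDiffeo φ ψ) (c : ℝ) :
    IsLocallyFiniteMeasure (imageMeasure φ ψ c) := by
  have : IsFiniteMeasureOnCompacts (imageMeasure φ ψ c) := by
    refine ⟨fun K hK => ?_⟩
    have h1 : IsLocallyFiniteMeasure
        ((leafMeasure c).withDensity fun x => ENNReal.ofReal ‖pullbackNormal φ ψ x‖) :=
      IsLocallyFiniteMeasure.withDensity_ofReal h.continuous_pullbackNormal.norm
    rw [imageMeasure, Measure.map_apply h.measurableEmbedding.measurable hK.measurableSet]
    exact (h.homeomorph.isCompact_preimage.2 hK).measure_lt_top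
  infer_instance

theorem measurable_imageNormal (h : IsDiffeo φ ψ) : Measurable (imageNormal φ ψ) := by
  have h1 : Measurable fun y => pullbackNormal φ ψ (ψ y) :=
    (h.continuous_pullbackNormal.comp h.contDiff_inv.continuous).measurable
  exact h1.norm.inv.smul h1

theorem isBoundary (h : IsDiffeo φ ψ) (c : ℝ) :
    IsBoundary (mult (φ '' {x | quadU x < c})) (imageMeasure φ ψ c) (imageNormal φ ψ) := by
  have hopen : IsOpen (φ '' {x | quadU x < c}) :=
    h.homeomorph.isOpenMap _ (isOpen_lt continuous_quadU continuous_const)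
  have hcast : ∀ x, (mult (φ '' {x | quadU x < c}) x : ℝ)
      = (φ '' {x | quadU x < c}).indicator (fun _ => (1 : ℝ)) x := by
    intro x
    by_cases hx : x ∈ φ '' {x | quadU x < c} <;> simp [mult, hx]
  have hd : Measurable fun x => ENNReal.ofReal ‖pullbackNormal φ ψ x‖ :=
    h.continuous_pullbackNormal.norm.measurable.ennreal_ofReal
  refine ⟨?_, h.isLocallyFiniteMeasure_imageMeasure c, h.measurable_imageNormal, ?_, ?_⟩
  · simp only [hcast]
    exact (locallyIntegrable_const (1 : ℝ)).indicator hopen.measurableSet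
  · rw [imageMeasure, h.measurableEmbedding.ae_map_iff, ae_withDensity_iff hd]
    refine .of_forall fun x hx => ?_
    have hne : ‖pullbackNormal φ ψ x‖ ≠ 0 := fun h0 => hx (by simp [h0])
    rw [imageNormal, h.left_inv, norm_smul, norm_inv, norm_norm, inv_mul_cancel₀ hne]
  · intro X hX hc
    have e1 : ∀ x, (mult (φ '' {x | quadU x < c}) x : ℝ) * divergence X x
        = (φ '' {x | quadU x < c}).indicator (divergence X) x := by
      intro x
      rw [hcast]
      by_cases hx : x ∈ φ '' {x | quadU x < c}
      · rw [indicator_of_mem hx, indicator_of_mem hx, one_mul]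
      · rw [indicator_of_notMem hx, indicator_of_notMem hx, zero_mul]
    simp only [e1]
    rw [integral_indicator hopen.measurableSet, h.integral_divergence c hX hc, imageMeasure,
      h.measurableEmbedding.integral_map,
      integral_withDensity_eq_integral_toReal_smul hd (by simp)]
    congr 1
    funext x
    rw [imageNormal, h.left_inv, inner_smul_right, ENNReal.toReal_ofReal (norm_nonneg _),
      smul_eq_mul]
    by_cases h0 : ‖pullbackNormal φ ψ x‖ = 0
    · rw [norm_eq_zero.1 h0]; simp
    · rw [mul_inv_cancel_left₀ h0]

/-- The length of the pulled back normal is the density of the area measure, and it is absorbed into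
`Phi0` by homogeneity. -/
theorem lintegral_imageMeasure (h : IsDiffeo φ ψ) (c : ℝ) {U : Set R6} (hU : MeasurableSet U) :
    ∫⁻ y in U, ENNReal.ofReal (Phi0 (imageNormal φ ψ y)) ∂imageMeasure φ ψ c
      = ∫⁻ x in φ ⁻¹' U, ENNReal.ofReal (Phi0 (pullbackNormal φ ψ x)) ∂leafMeasure c := by
  have hd : Measurable fun x => ENNReal.ofReal ‖pullbackNormal φ ψ x‖ :=
    h.continuous_pullbackNormal.norm.measurable.ennreal_ofReal
  have hm : Measurable fun x => ENNReal.ofReal (Phi0 (imageNormal φ ψ (φ x))) :=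
    ((continuous_Phi0.measurable.comp h.measurable_imageNormal).comp
      h.contDiff.continuous.measurable).ennreal_ofReal
  have hU' : MeasurableSet (φ ⁻¹' U) := h.contDiff.continuous.measurable hU
  rw [imageMeasure, h.measurableEmbedding.restrict_map, h.measurableEmbedding.lintegral_map,
    setLIntegral_withDensity_eq_setLIntegral_mul _ hd hm hU']
  refine lintegral_congr fun x => ?_
  rw [Pi.mul_apply, imageNormal, h.left_inv, Phi0_smul, ← ENNReal.ofReal_mul (norm_nonneg _),
    abs_of_nonneg (inv_nonneg.2 (norm_nonneg _))]
  by_cases h0 : ‖pullbackNormal φ ψ x‖ = 0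
  · have h1 : Phi0 0 = 0 := by simpa using Phi0_smul 0 0
    rw [norm_eq_zero.1 h0, h1]; simp
  · rw [mul_inv_cancel_left₀ h0]

theorem functional_le (h : IsDiffeo φ ψ) (c : ℝ) {U : Set R6} (hU : MeasurableSet U) :
    functional Phi0 (mult (φ '' {x | quadU x < c})) U
      ≤ ∫⁻ x in φ ⁻¹' U, ENNReal.ofReal (Phi0 (pullbackNormal φ ψ x)) ∂leafMeasure c :=
  (iInf₂_le_of_le _ _ (iInf_le _ (h.isBoundary c))).trans_eq (h.lintegral_imageMeasure c hU)

theorem lintegral_ne_top (h : IsDiffeo φ ψ) (c : ℝ) {U : Set R6} (hU : Bornology.IsBounded U) :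
    ∫⁻ x in U, ENNReal.ofReal (Phi0 (pullbackNormal φ ψ x)) ∂leafMeasure c ≠ ⊤ := by
  have hcont : Continuous fun x => Phi0 (pullbackNormal φ ψ x) :=
    continuous_Phi0.comp h.continuous_pullbackNormal
  have hK : IsCompact (closure U) := hU.isCompact_closure
  have hi : IntegrableOn (fun x => Phi0 (pullbackNormal φ ψ x)) U (leafMeasure c) :=
    (hcont.continuousOn.integrableOn_compact hK).mono_set subset_closure
  exact ((hasFiniteIntegral_iff_ofReal (.of_forall fun x => Phi0_nonneg _)).1 hi.2).ne

end IsDiffeo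

/-! ### Calibrated lower bounds -/

theorem functional_sublevel_le (c : ℝ) {U : Set R6} (hU : MeasurableSet U) :
    functional Phi0 (mult {x | quadU x < c}) U
      ≤ ∫⁻ x in U, ENNReal.ofReal (Phi0 (gradU x)) ∂leafMeasure c := by
  have h := isDiffeo_id.functional_le c hU
  simpa only [image_id, preimage_id, pullbackNormal_id] using h

theorem lintegral_gradU_ne_top (c : ℝ) {U : Set R6} (hU : Bornology.IsBounded U) :
    ∫⁻ x in U, ENNReal.ofReal (Phi0 (gradU x)) ∂leafMeasure c ≠ ⊤ := by
  have h := isDiffeo_id.lintegral_ne_top c hU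
  simpa only [pullbackNormal_id] using h

theorem divergence_smul_calib {w : ℝ} (hw : 0 < w) {η : R6 → ℝ} (hη : ContDiff ℝ 1 η) (x : R6) :
    divergence (fun x => η x • calib w x) x = fderiv ℝ η x (calib w x) := by
  have h1 : DifferentiableAt ℝ η x := hη.differentiable one_ne_zero x
  have h2 : DifferentiableAt ℝ (calib w) x :=
    (contDiff_calib (n := 1) hw).differentiable one_ne_zero x
  have h3 : fderiv ℝ (fun x => η x • calib w x) x
      = η x • fderiv ℝ (calib w) x + (fderiv ℝ η x).smulRight (calib w x) := fderiv_fun_smul h1 h2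
  have h4 := divergence_calib hw x
  rw [divergence] at h4
  rw [divergence, h3, apply_eq_sum (fderiv ℝ η x)]
  simp only [add_apply, smul_apply,
    ContinuousLinearMap.smulRight_apply, PiLp.add_apply, PiLp.smul_apply, smul_eq_mul,
    Finset.sum_add_distrib, ← Finset.mul_sum, h4, mul_zero, zero_add, mul_comm]

theorem IsBoundary.integrable_mul_Phi0 {g : R6 → ℤ} {μ : Measure R6} {ν : R6 → R6}
    (hb : IsBoundary g μ ν) {η : R6 → ℝ} (hη : Continuous η) (hηc : HasCompactSupport η) :
    Integrable (fun x => η x * Phi0 (ν x)) μ := by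
  have := hb.locallyFinite
  have hηi : Integrable η μ := hη.integrable_of_hasCompactSupport hηc
  refine (hηi.norm.mul_const 6).mono' (hη.aestronglyMeasurable.mul
    (continuous_Phi0.measurable.comp hb.measurable_normal).aestronglyMeasurable) ?_
  filter_upwards [hb.norm_normal] with x hx
  rw [norm_mul]
  refine mul_le_mul_of_nonneg_left ?_ (norm_nonneg _)
  have h1 : Phi0 0 = 0 := by simpa using Phi0_smul 0 0
  have h2 := Phi0_sub_le (ν x) 0
  rw [h1, sub_zero, sub_zero, hx] at h2
  rw [Real.norm_eq_abs, abs_of_nonneg (Phi0_nonneg _)]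
  linarith

/-- A calibrated comparison: the energy of the cut off level set of `quadU` bounds from below the
energy of every competitor. -/
theorem integral_calibration_le {c : ℝ} {g : R6 → ℤ} {μ : Measure R6} {ν : R6 → R6}
    (hb : IsBoundary g μ ν) {η : R6 → ℝ} (hη : ContDiff ℝ 1 η) (hηc : HasCompactSupport η)
    (hη0 : ∀ x, 0 ≤ η x) (hg : ∀ x, g x ≠ mult {x | quadU x < c} x → fderiv ℝ η x = 0) :
    ∫ x, η x * Phi0 (gradU x) ∂leafMeasure c ≤ ∫ x, η x * Phi0 (ν x) ∂μ := by
  have := hb.locallyFinite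
  have hηcont := hη.continuous
  have key : ∀ w : ℝ, 0 < w → ∫ x, η x * inner ℝ (calib w x) (gradU x) ∂leafMeasure c
      ≤ ∫ x, η x * Phi0 (ν x) ∂μ := by
    intro w hw
    have hcal : Continuous (calib w) := (contDiff_calib (n := 0) hw).continuous
    have hX : ContDiff ℝ 1 fun x => η x • calib w x := hη.smul (contDiff_calib hw)
    have hXc : HasCompactSupport fun x => η x • calib w x := hηc.smul_right
    have e0' := isDiffeo_id.integral_divergence c hX hXc
    have e1 := hb.gauss_green _ hX hXc
    -- As `calib w` is divergence free, only `dη(calib w)` survives, and it vanishes wherever `g`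
    -- differs from the sublevel set. So both boundaries have the same flux.
    have e2 : ∀ x, (g x : ℝ) * divergence (fun x => η x • calib w x) x
        = {x | quadU x < c}.indicator (divergence fun x => η x • calib w x) x := by
      intro x
      rw [divergence_smul_calib hw hη]
      by_cases hx : g x = mult {x | quadU x < c} x
      · rw [hx, mult]
        by_cases hxu : x ∈ {x | quadU x < c}
        · rw [indicator_of_mem hxu, indicator_of_mem hxu, divergence_smul_calib hw hη]; simp
        · rw [indicator_of_notMem hxu, indicator_of_notMem hxu]; simp
      · have h0 : fderiv ℝ η x (calib w x) = 0 := by rw [hg x hx]; rfl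
        rw [h0, mul_zero]
        by_cases hxu : x ∈ {x | quadU x < c}
        · rw [indicator_of_mem hxu, divergence_smul_calib hw hη, h0]
        · rw [indicator_of_notMem hxu]
    simp only [e2] at e1
    rw [integral_indicator (isOpen_lt continuous_quadU continuous_const).measurableSet] at e1
    rw [image_id] at e0'
    simp only [id, pullbackNormal_id] at e0'
    rw [e0'] at e1
    simp only [real_inner_smul_left] at e1
    rw [e1]
    have hi0 : Integrable (fun x => η x * inner ℝ (calib w x) (ν x)) μ := by
      refine ((hηcont.norm.mul hcal.norm).integrable_of_hasCompactSupport
        hηc.norm.mul_right).mono' (hηcont.aestronglyMeasurable.mul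
        (hcal.measurable.inner hb.measurable_normal).aestronglyMeasurable) ?_
      filter_upwards [hb.norm_normal] with x hx
      rw [norm_mul]
      refine mul_le_mul_of_nonneg_left ?_ (norm_nonneg _)
      simpa [hx] using norm_inner_le_norm (𝕜 := ℝ) (calib w x) (ν x)
    exact integral_mono hi0 (hb.integrable_mul_Phi0 hηcont hηc)
      fun x => mul_le_mul_of_nonneg_left (inner_calib_le hw x (ν x)) (hη0 x)
  have hlim : Tendsto (fun w => ∫ x, η x * inner ℝ (calib w x) (gradU x) ∂leafMeasure c)
      (𝓝[>] 0) (𝓝 (∫ x, η x * Phi0 (gradU x) ∂leafMeasure c)) := by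
    refine tendsto_integral_filter_of_dominated_convergence
      (fun x => ‖η x‖ * Phi0 (gradU x)) ?_ ?_ ?_ (.of_forall fun x => ?_)
    · filter_upwards [self_mem_nhdsWithin] with w hw
      have hcal : Continuous (calib w) := (contDiff_calib (n := 0) hw).continuous
      exact Continuous.aestronglyMeasurable (by fun_prop)
    · filter_upwards [self_mem_nhdsWithin] with w hw
      refine .of_forall fun x => ?_
      rw [norm_mul]
      refine mul_le_mul_of_nonneg_left (abs_le.2 ⟨?_, inner_calib_le hw _ _⟩) (norm_nonneg _)
      -- `Phi0` is even, so the calibration inequality for the opposite normal bounds the pairing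
      -- from below and dominates the integrand uniformly in `w`.
      have h1 := inner_calib_le hw x (-gradU x)
      rw [Phi0_neg, inner_neg_right] at h1
      linarith
    · exact Continuous.integrable_of_hasCompactSupport (by fun_prop) hηc.norm.mul_right
    · exact (tendsto_inner_calib x).const_mul _
  refine le_of_tendsto hlim ?_
  filter_upwards [self_mem_nhdsWithin] with w hw using key w hw

open scoped Manifold in
theorem exists_cutoff {K U : Set R6} (hK : IsCompact K) (hU : IsOpen U) (hKU : K ⊆ U) :
    ∃ η : R6 → ℝ, ContDiff ℝ 1 η ∧ HasCompactSupport η ∧ (∀ x, 0 ≤ η x ∧ η x ≤ 1) ∧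
      (∀ x ∉ U, η x = 0) ∧ (∀ x ∈ K, η x = 1) ∧ ∀ x ∈ K, fderiv ℝ η x = 0 := by
  obtain ⟨L, hL, hKL, hLU⟩ := exists_compact_between hK hU hKU
  obtain ⟨f, h1, h0, h01⟩ := exists_contMDiffMap_one_nhds_of_subset_interior (n := 1)
    𝓘(ℝ, R6) hK.isClosed hKL
  refine ⟨f, f.contMDiff.contDiff, ?_, h01, fun x hx => h0 x fun h => hx (hLU h),
    fun x hx => h1.self_of_nhdsSet x hx, fun x hx => ?_⟩
  · refine HasCompactSupport.of_support_subset_isCompact hL fun x hx => ?_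
    by_contra hc
    exact hx (h0 x hc)
  · have h2 : (f : R6 → ℝ) =ᶠ[𝓝 x] fun _ => 1 := h1.filter_mono (nhds_le_nhdsSet hx)
    rw [h2.fderiv_eq]; simp

/-- The level sets of `quadU` are calibrated: their energy is at most that of any competitor. -/
theorem lintegral_gradU_le_functional (c : ℝ) {U : Set R6} (hU : IsOpen U)
    (hUb : Bornology.IsBounded U) {g : R6 → ℤ}
    (hg : closure {x | g x ≠ mult {x | quadU x < c} x} ⊆ U) :
    ∫⁻ x in U, ENNReal.ofReal (Phi0 (gradU x)) ∂leafMeasure c ≤ functional Phi0 g U := by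
  refine le_iInf₂ fun μ ν => le_iInf fun hb => ?_
  have := hb.locallyFinite
  have hcont : Continuous fun x => Phi0 (gradU x) := by fun_prop
  have hlf : IsLocallyFiniteMeasure
      ((leafMeasure c).withDensity fun x => ENNReal.ofReal (Phi0 (gradU x))) :=
    IsLocallyFiniteMeasure.withDensity_ofReal hcont
  -- A cutoff supported in `U` cannot equal one on all of `U`; inner regularity reduces the bound to
  -- compact `K ⊆ U`. The cutoff is then one on `K` and locally constant at the modified region.
  rw [← withDensity_apply _ hU.measurableSet, hU.measure_eq_iSup_isCompact]
  refine iSup₂_le fun K hKU => iSup_le fun hK => ?_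
  rw [withDensity_apply _ hK.measurableSet]
  have hC : IsCompact (closure {x | g x ≠ mult {x | quadU x < c} x}) :=
    Metric.isCompact_of_isClosed_isBounded isClosed_closure (hUb.subset hg)
  obtain ⟨η, hη, hηc, h01, hη0, hη1, hηd⟩ := exists_cutoff (hK.union hC) hU (union_subset hKU hg)
  have hηcont := hη.continuous
  have hle := integral_calibration_le (c := c) hb hη hηc (fun x => (h01 x).1)
    fun x hx => hηd x (Or.inr (subset_closure hx))
  calc
    ∫⁻ x in K, ENNReal.ofReal (Phi0 (gradU x)) ∂leafMeasure c
        = ∫⁻ x in K, ENNReal.ofReal (η x * Phi0 (gradU x)) ∂leafMeasure c :=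
      setLIntegral_congr_fun hK.measurableSet fun x hx => by
        simp only [hη1 x (Or.inl hx), one_mul]
    _ ≤ ∫⁻ x, ENNReal.ofReal (η x * Phi0 (gradU x)) ∂leafMeasure c := setLIntegral_le_lintegral _ _
    _ = ENNReal.ofReal (∫ x, η x * Phi0 (gradU x) ∂leafMeasure c) := by
      refine (ofReal_integral_eq_lintegral_ofReal ?_ (.of_forall fun x =>
        mul_nonneg (h01 x).1 (Phi0_nonneg _))).symm
      exact Continuous.integrable_of_hasCompactSupport (by fun_prop) hηc.mul_right
    _ ≤ ENNReal.ofReal (∫ x, η x * Phi0 (ν x) ∂μ) := ENNReal.ofReal_le_ofReal hle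
    _ = ∫⁻ x, ENNReal.ofReal (η x * Phi0 (ν x)) ∂μ :=
      ofReal_integral_eq_lintegral_ofReal (hb.integrable_mul_Phi0 hηcont hηc)
        (.of_forall fun x => mul_nonneg (h01 x).1 (Phi0_nonneg _))
    _ ≤ ∫⁻ x, U.indicator (fun x => ENNReal.ofReal (Phi0 (ν x))) x ∂μ := by
      refine lintegral_mono fun x => ?_
      by_cases hx : x ∈ U
      · rw [indicator_of_mem hx]
        exact ENNReal.ofReal_le_ofReal (mul_le_of_le_one_left (Phi0_nonneg _) (h01 x).2)
      · simp [hη0 x hx]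
    _ = ∫⁻ x in U, ENNReal.ofReal (Phi0 (ν x)) ∂μ := lintegral_indicator hU.measurableSet _

/-- The lower bound is the calibration inequality with the sublevel set as its own competitor. -/
theorem functional_sublevel (c : ℝ) {U : Set R6} (hU : IsOpen U) (hUb : Bornology.IsBounded U) :
    functional Phi0 (mult {x | quadU x < c}) U
      = ∫⁻ x in U, ENNReal.ofReal (Phi0 (gradU x)) ∂leafMeasure c :=
  (functional_sublevel_le c hU.measurableSet).antisymm
    (lintegral_gradU_le_functional c hU hUb (by simp))

/-- The sublevel sets of `quadU` minimize the energy. -/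
theorem isMinimizer_sublevel (c : ℝ) : IsMinimizer Phi0 {x | quadU x < c} := by
  intro U hU hUb
  rw [functional_sublevel c hU hUb]
  exact ⟨lintegral_gradU_ne_top c hUb, fun g hg => lintegral_gradU_le_functional c hU hUb hg⟩

/-! ### Cofactors -/

/-- The index set of the coordinates of `ℝ⁶`. -/
abbrev I6 : Type := Fin 3 ⊕ Fin 3

/-- The matrix of a linear endomorphism of `ℝ⁶`. -/
noncomputable def toMat (A : R6 →L[ℝ] R6) : Matrix I6 I6 ℝ :=
  Matrix.of fun i j => A (EuclideanSpace.basisFun I6 ℝ j) i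

theorem toMat_eq_toMatrix (A : R6 →L[ℝ] R6) :
    toMat A = LinearMap.toMatrix (EuclideanSpace.basisFun I6 ℝ).toBasis
      (EuclideanSpace.basisFun I6 ℝ).toBasis (A : R6 →ₗ[ℝ] R6) := by
  ext i j
  simp [toMat, LinearMap.toMatrix_apply]

theorem det_toMat (A : R6 →L[ℝ] R6) : (toMat A).det = A.det := by
  rw [toMat_eq_toMatrix, LinearMap.det_toMatrix]

theorem toMat_mul {A B : R6 →L[ℝ] R6} (h : A.comp B = ContinuousLinearMap.id ℝ R6) :
    toMat A * toMat B = 1 := by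
  have h' : (A : R6 →ₗ[ℝ] R6) ∘ₗ (B : R6 →ₗ[ℝ] R6) = LinearMap.id := by
    ext1 v
    exact DFunLike.congr_fun h v
  rw [toMat_eq_toMatrix, toMat_eq_toMatrix, ← LinearMap.toMatrix_comp, h', LinearMap.toMatrix_id]

/-- The cofactor matrix of `M` applied to `v`. -/
noncomputable def cofactorMul (M : Matrix I6 I6 ℝ) (v : R6) : R6 :=
  WithLp.toLp 2 fun j => ∑ i, M.adjugate i j * v i

theorem cofactorMul_one (v : R6) : cofactorMul 1 v = v := by
  ext j
  simp [cofactorMul, Matrix.one_apply]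

/-- Multiplying `A B = 1` by the adjugate gives `adj A = det A • B`. The result is polynomial in the
entries of `A` and no longer mentions the inverse `B`, so it can be differentiated along a
deformation. -/
theorem det_smul_adjoint {A B : R6 →L[ℝ] R6} (h : A.comp B = ContinuousLinearMap.id ℝ R6)
    (v : R6) : A.det • ContinuousLinearMap.adjoint B v = cofactorMul (toMat A) v := by
  have h1 : (toMat A).adjugate = A.det • toMat B := by
    have := congrArg (fun N => (toMat A).adjugate * N) (toMat_mul h)
    simp only [← Matrix.mul_assoc, Matrix.adjugate_mul, Matrix.mul_one, Matrix.smul_mul,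
      Matrix.one_mul, det_toMat] at this
    exact this.symm
  ext j
  have h2 : ContinuousLinearMap.adjoint B v j = ∑ i, toMat B i j * v i := by
    have h3 : ContinuousLinearMap.adjoint B v j
        = inner ℝ (EuclideanSpace.basisFun I6 ℝ j) (ContinuousLinearMap.adjoint B v) := by
      simp [EuclideanSpace.inner_single_left]
    rw [h3, ContinuousLinearMap.adjoint_inner_right, PiLp.inner_apply]
    simp [toMat, mul_comm]
  rw [PiLp.smul_apply, h2, cofactorMul, h1, smul_eq_mul, Finset.mul_sum]
  simp [mul_assoc]

theorem contDiff_det {E : Type*} [NormedAddCommGroup E] [NormedSpace ℝ E] {n : WithTop ℕ∞}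
    {M : E → Matrix I6 I6 ℝ} (hM : ∀ i j, ContDiff ℝ n fun x => M x i j) :
    ContDiff ℝ n fun x => (M x).det := by
  simp only [Matrix.det_apply']
  exact ContDiff.sum fun σ _ => contDiff_const.mul (contDiff_prod fun i _ => hM _ _)

theorem contDiff_cofactorMul {E : Type*} [NormedAddCommGroup E] [NormedSpace ℝ E]
    {n : WithTop ℕ∞} {M : E → Matrix I6 I6 ℝ} {v : E → R6}
    (hM : ∀ i j, ContDiff ℝ n fun x => M x i j) (hv : ContDiff ℝ n v) :
    ContDiff ℝ n fun x => cofactorMul (M x) (v x) := by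
  rw [contDiff_euclidean]
  intro j
  change ContDiff ℝ n fun x => ∑ i, (M x).adjugate i j * v x i
  refine ContDiff.sum fun i _ => ContDiff.mul ?_ (contDiff_euclidean.1 hv i)
  simp only [Matrix.adjugate_apply]
  refine contDiff_det fun k l => ?_
  by_cases hk : k = j
  · subst hk; simp only [Matrix.updateRow_self]; exact contDiff_const
  · simp only [Matrix.updateRow_ne hk]; exact hM k l

/-! ### Deformations -/

section Deformation

variable {X : R6 → R6}

/-- The deformation of `ℝ⁶` along a vector field. -/
noncomputable def deform (X : R6 → R6) (t : ℝ) (x : R6) : R6 := x + t • X x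

theorem fderiv_deform (hX : ContDiff ℝ ∞ X) (t : ℝ) (x : R6) :
    HasFDerivAt (deform X t) (ContinuousLinearMap.id ℝ R6 + t • fderiv ℝ X x) x :=
  (hasFDerivAt_id x).add ((hX.differentiable (by simp) x).hasFDerivAt.const_smul t)

/-- If `L` is a Lipschitz constant of `X` and `|t| L < 1`, the map is a perturbation of the identity
with Lipschitz constant below one, hence a homeomorphism. The same bound on `t DX` makes each
differential invertible by a Neumann series. -/
theorem exists_isDiffeo_deform (hX : ContDiff ℝ ∞ X) (hc : HasCompactSupport X) :
    ∀ᶠ t : ℝ in 𝓝 0, ∃ ψ, IsDiffeo (deform X t) ψ := by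
  obtain ⟨L, hL⟩ := hX.lipschitzWith_of_hasCompactSupport hc (by simp)
  have hev : ∀ᶠ t : ℝ in 𝓝 0, ‖t‖₊ * L < 1 := by
    have : Continuous fun t : ℝ => ‖t‖₊ * L := by fun_prop
    refine this.continuousAt.eventually_lt continuousAt_const ?_
    simp
  filter_upwards [hev] with t ht
  have happ : ApproximatesLinearOn (deform X t)
      ((ContinuousLinearEquiv.refl ℝ R6 : R6 ≃L[ℝ] R6) : R6 →L[ℝ] R6) univ (‖t‖₊ * L) := by
    intro x _ y _
    have e : deform X t x - deform X t y
        - ((ContinuousLinearEquiv.refl ℝ R6 : R6 ≃L[ℝ] R6) : R6 →L[ℝ] R6) (x - y)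
        = t • (X x - X y) := by
      simp only [deform, ContinuousLinearEquiv.coe_refl, ContinuousLinearMap.coe_id', id, smul_sub]
      abel
    rw [e, norm_smul, NNReal.coe_mul, coe_nnnorm, mul_assoc]
    exact mul_le_mul_of_nonneg_left (hL.norm_sub_le x y) (norm_nonneg _)
  have hinv : Subsingleton R6 ∨ ‖t‖₊ * L
      < ‖((ContinuousLinearEquiv.refl ℝ R6 : R6 ≃L[ℝ] R6).symm : R6 →L[ℝ] R6)‖₊⁻¹ := by
    right
    have h1 : ‖((ContinuousLinearEquiv.refl ℝ R6 : R6 ≃L[ℝ] R6).symm : R6 →L[ℝ] R6)‖₊ = 1 := by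
      rw [ContinuousLinearEquiv.refl_symm, ContinuousLinearEquiv.coe_refl]
      exact ContinuousLinearMap.nnnorm_id
    rwa [h1, inv_one]
  set e := happ.toHomeomorph (deform X t) hinv with he
  have hcoe : (e : R6 → R6) = deform X t := rfl
  have hunit : ∀ x, ∃ A : R6 ≃L[ℝ] R6,
      (A : R6 →L[ℝ] R6) = ContinuousLinearMap.id ℝ R6 + t • fderiv ℝ X x := by
    intro x
    have h1 : ‖-(t • fderiv ℝ X x)‖ < 1 := by
      rw [norm_neg, norm_smul]
      have h2 : ‖fderiv ℝ X x‖ ≤ L := norm_fderiv_le_of_lipschitz ℝ hL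
      have h3 : ‖t‖ * (L : ℝ) < 1 := by exact_mod_cast ht
      exact (mul_le_mul_of_nonneg_left h2 (norm_nonneg _)).trans_lt h3
    refine ⟨ContinuousLinearEquiv.unitsEquiv ℝ R6 (Units.oneSub _ h1), ?_⟩
    ext v
    simp
  choose A hA using hunit
  have hdc : ContDiff ℝ 1 (deform X t) :=
    contDiff_id.add ((hX.of_le (by simp)).const_smul t)
  refine ⟨e.symm, hdc, ?_, e.symm_apply_apply, e.apply_symm_apply⟩
  exact e.contDiff_symm (f₀' := A) (fun x => by rw [hA]; exact fderiv_deform hX t x) hdc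

theorem deform_of_notMem {x : R6} (hx : x ∉ tsupport X) (t : ℝ) : deform X t x = x := by
  rw [deform, image_eq_zero_of_notMem_tsupport hx, smul_zero, add_zero]

/-- If the image of `x` were outside the support it would be a fixed point, and injectivity would
identify it with `x`. -/
theorem IsDiffeo.deform_mem {t : ℝ} {ψ : R6 → R6} (h : IsDiffeo (deform X t) ψ) {x : R6}
    (hx : x ∈ tsupport X) : deform X t x ∈ tsupport X := by
  by_contra hn
  exact hn ((h.injective (deform_of_notMem hn t)).symm ▸ hx)

theorem IsDiffeo.preimage_deform {t : ℝ} {ψ : R6 → R6} (h : IsDiffeo (deform X t) ψ)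
    {U : Set R6} (hU : tsupport X ⊆ U) : deform X t ⁻¹' U = U := by
  ext x
  by_cases hx : x ∈ tsupport X
  · exact ⟨fun _ => hU hx, fun _ => hU (h.deform_mem hx)⟩
  · rw [mem_preimage, deform_of_notMem hx]

theorem IsDiffeo.mem_image_deform {t : ℝ} {ψ : R6 → R6} (h : IsDiffeo (deform X t) ψ)
    {E : Set R6} {x : R6} (hx : x ∉ tsupport X) : x ∈ deform X t '' E ↔ x ∈ E := by
  conv_lhs => rw [← deform_of_notMem hx t]
  exact h.injective.mem_set_image

/-- The deformed normal. -/
noncomputable def deformNormal (X : R6 → R6) (t : ℝ) (x : R6) : R6 :=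
  cofactorMul (toMat (ContinuousLinearMap.id ℝ R6 + t • fderiv ℝ X x)) (gradU x)

theorem contDiff_deformNormal (hX : ContDiff ℝ ∞ X) {E : Type*} [NormedAddCommGroup E]
    [NormedSpace ℝ E] {f : E → ℝ} {g : E → R6} (hf : ContDiff ℝ 1 f) (hg : ContDiff ℝ 1 g) :
    ContDiff ℝ 1 fun a => deformNormal X (f a) (g a) := by
  have h1 : ContDiff ℝ 1 (fderiv ℝ X) := hX.fderiv_right (by norm_cast)
  refine contDiff_cofactorMul (fun i j => ?_) (contDiff_gradU.comp hg)
  have h2 : ContDiff ℝ 1 fun a : E => (ContinuousLinearMap.id ℝ R6 + f a • fderiv ℝ X (g a))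
      (EuclideanSpace.basisFun I6 ℝ j) :=
    (contDiff_const.add (hf.smul (h1.comp hg))).clm_apply contDiff_const
  exact contDiff_euclidean.1 h2 i

theorem continuous_Phi0_comp₂ {Y : Type*} [TopologicalSpace Y] {N : ℝ → R6 → R6}
    (hN : Continuous fun a : ℝ × R6 => N a.1 a.2) {f : Y → ℝ} {g : Y → R6} (hf : Continuous f)
    (hg : Continuous g) : Continuous fun y => Phi0 (N (f y) (g y)) := by
  have h0 : Continuous fun y => N (f y) (g y) := hN.comp₂ hf hg
  exact continuous_Phi0.comp h0

theorem continuous_Phi0_deformNormal (hX : ContDiff ℝ ∞ X) {Y : Type*} [TopologicalSpace Y]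
    {f : Y → ℝ} {g : Y → R6} (hf : Continuous f) (hg : Continuous g) :
    Continuous fun a => Phi0 (deformNormal X (f a) (g a)) := by
  have h0 : Continuous fun a : ℝ × R6 => deformNormal X a.1 a.2 :=
    (contDiff_deformNormal hX contDiff_fst contDiff_snd).continuous
  exact continuous_Phi0_comp₂ h0 hf hg

theorem deformNormal_zero (x : R6) : deformNormal X 0 x = gradU x := by
  have h : toMat (ContinuousLinearMap.id ℝ R6) = 1 := by
    rw [toMat_eq_toMatrix, ContinuousLinearMap.coe_id, LinearMap.toMatrix_id]
  have h0 : ContinuousLinearMap.id ℝ R6 + (0 : ℝ) • fderiv ℝ X x = ContinuousLinearMap.id ℝ R6 := by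
    ext v; simp
  rw [deformNormal, h0, h, cofactorMul_one]

/-- The two normals differ at most by the sign of the determinant, which the even function `Phi0`
does not see. -/
theorem IsDiffeo.Phi0_pullbackNormal {t : ℝ} {ψ : R6 → R6} (h : IsDiffeo (deform X t) ψ)
    (hX : ContDiff ℝ ∞ X) (x : R6) :
    Phi0 (pullbackNormal (deform X t) ψ x) = Phi0 (deformNormal X t x) := by
  have h1 := fderiv_deform hX t x
  have h2 : HasFDerivAt ψ (fderiv ℝ ψ (deform X t x)) (deform X t x) :=
    (h.contDiff_inv.differentiable one_ne_zero _).hasFDerivAt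
  have h3 : HasFDerivAt (deform X t) (ContinuousLinearMap.id ℝ R6 + t • fderiv ℝ X x)
      (ψ (deform X t x)) := by rw [h.left_inv]; exact h1
  have h4 := h3.comp (deform X t x) h2
  have h5 : deform X t ∘ ψ = id := funext h.right_inv
  rw [h5] at h4
  have h6 := h4.unique (hasFDerivAt_id _)
  rw [deformNormal, ← det_smul_adjoint h6, pullbackNormal, h1.fderiv, Phi0_smul, Phi0_smul, abs_abs]

/-- The energy of the deformed level set of `quadU`. -/
noncomputable def deformEnergy (X : R6 → R6) (c : ℝ) (U : Set R6) (t : ℝ) : ℝ :=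
  ∫ x in U, Phi0 (deformNormal X t x) ∂leafMeasure c

/-- Differentiation under the integral sign. The integrand is Lipschitz in `t` with constant `6 C`,
from the constant `6` of `Phi0` and a constant `C` of the deformed normal on a compact set. On `{u =
c}` with `c ≠ 0` the gradient `(p, -q)` has `|p| ≠ |q|`, so `Phi0` is differentiable there. -/
theorem differentiableAt_deformEnergy (hX : ContDiff ℝ ∞ X) {c : ℝ} (hc : c ≠ 0) {U : Set R6}
    (hUm : MeasurableSet U) (hU : Bornology.IsBounded U) :
    DifferentiableAt ℝ (deformEnergy X c U) 0 := by
  obtain ⟨R, hR⟩ := hU.subset_closedBall 0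
  have hfin : leafMeasure c U ≠ ⊤ :=
    ((measure_mono subset_closure).trans_lt hU.isCompact_closure.measure_lt_top).ne
  have hN : ContDiff ℝ 1 fun a : ℝ × R6 => deformNormal X a.1 a.2 :=
    contDiff_deformNormal hX contDiff_fst contDiff_snd
  obtain ⟨C, hC⟩ := (hN.locallyLipschitz.locallyLipschitzOn (s := Icc (-1 : ℝ) 1
    ×ˢ Metric.closedBall (0 : R6) R)).exists_lipschitzOnWith_of_compact
    (isCompact_Icc.prod (isCompact_closedBall _ _))
  have hmain := hasDerivAt_integral_of_dominated_loc_of_lip (μ := (leafMeasure c).restrict U)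
    (F := fun t x => Phi0 (deformNormal X t x)) (x₀ := (0 : ℝ)) (s := Icc (-1) 1)
    (F' := fun x => deriv (fun t => Phi0 (deformNormal X t x)) 0) (bound := fun _ => (6 * C : ℝ))
    (Icc_mem_nhds (by norm_num) (by norm_num)) ?_ ?_ ?_ ?_ ?_ ?_
  · exact hmain.2.differentiableAt
  · exact .of_forall fun t =>
      (continuous_Phi0_deformNormal hX continuous_const continuous_id).aestronglyMeasurable
  · have h0 : Continuous fun x : R6 => Phi0 (deformNormal X 0 x) :=
      continuous_Phi0_deformNormal hX continuous_const continuous_id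
    exact ((h0.continuousOn.integrableOn_compact hU.isCompact_closure).mono_set subset_closure)
  · have h1 := measurable_deriv_with_param
      (f := fun (x : R6) (t : ℝ) => Phi0 (deformNormal X t x))
      (continuous_Phi0_deformNormal hX continuous_snd continuous_fst)
    exact (h1.comp (measurable_id.prodMk measurable_const)).aestronglyMeasurable
  · refine ae_restrict_of_forall_mem hUm fun x hx => LipschitzOnWith.of_dist_le_mul fun t ht s hs => ?_
    have h1 := lipschitzWith_Phi0.dist_le_mul (deformNormal X t x) (deformNormal X s x)
    have h2 := hC.dist_le_mul (t, x) ⟨ht, hR hx⟩ (s, x) ⟨hs, hR hx⟩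
    rw [Prod.dist_eq, dist_self, max_eq_left dist_nonneg] at h2
    have h3 : ((Real.nnabs (6 * C : ℝ) : NNReal) : ℝ) = 6 * C := by
      rw [Real.coe_nnabs, abs_of_nonneg (by positivity)]
    rw [h3, mul_assoc]
    exact h1.trans (mul_le_mul_of_nonneg_left h2 (by simp))
  · exact integrableOn_const hfin
  · filter_upwards [ae_restrict_of_ae (ae_leafMeasure_quadU c)] with x hx
    refine DifferentiableAt.hasDerivAt ?_
    have h1 : DifferentiableAt ℝ Phi0 (deformNormal X 0 x) := by
      rw [deformNormal_zero]
      refine differentiableAt_Phi0 fun heq => hc ?_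
      rw [pPart_gradU, qPart_gradU, norm_neg] at heq
      rw [← hx, quadU, heq, sub_self, zero_div]
    have h2 : DifferentiableAt ℝ (fun t : ℝ => deformNormal X t x) 0 :=
      (contDiff_deformNormal hX contDiff_id contDiff_const).differentiable one_ne_zero 0
    exact h1.comp (0 : ℝ) h2

/-- The nonzero level sets of `quadU` are critical points of the energy. -/
theorem isCriticalPoint_sublevel {c : ℝ} (hc : c ≠ 0) :
    IsCriticalPoint Phi0 {x | quadU x < c} := by
  intro X hX hXc U hU hUb hXU
  have hdiffeo := exists_isDiffeo_deform hX hXc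
  have hdef : ∀ t : ℝ, (fun x => x + t • X x) = deform X t := fun t => rfl
  have hFt : ∀ t, ∫⁻ x in U, ENNReal.ofReal (Phi0 (deformNormal X t x)) ∂leafMeasure c
      = ENNReal.ofReal (deformEnergy X c U t) := by
    intro t
    have h0 : Continuous fun x : R6 => Phi0 (deformNormal X t x) :=
      continuous_Phi0_deformNormal hX continuous_const continuous_id
    refine (ofReal_integral_eq_lintegral_ofReal ?_ (.of_forall fun x => Phi0_nonneg _)).symm
    exact ((h0.continuousOn.integrableOn_compact hUb.isCompact_closure).mono_set subset_closure)
  have hF0 : ∀ t, 0 ≤ deformEnergy X c U t := fun t =>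
    integral_nonneg fun x => Phi0_nonneg _
  -- The lower bound is minimality, as the deformation changes the set only inside the support of
  -- `X`; the upper bound is the explicit boundary of the image. Equality with `deformEnergy` is not
  -- needed.
  have hbounds : ∀ᶠ t : ℝ in 𝓝 0,
      ENNReal.ofReal (deformEnergy X c U 0)
        ≤ functional Phi0 (mult ((fun x => x + t • X x) '' {x | quadU x < c})) U ∧
      functional Phi0 (mult ((fun x => x + t • X x) '' {x | quadU x < c})) U
        ≤ ENNReal.ofReal (deformEnergy X c U t) := by
    filter_upwards [hdiffeo] with t ⟨ψ, h⟩
    rw [hdef]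
    constructor
    · rw [← hFt 0]
      simp only [deformNormal_zero]
      refine lintegral_gradU_le_functional c hU hUb (subset_trans ?_ hXU)
      refine closure_minimal (fun x hx => ?_) (isClosed_tsupport X)
      by_contra hn
      refine hx ?_
      have := h.mem_image_deform hn (E := {x | quadU x < c})
      by_cases hm : x ∈ {x | quadU x < c}
      · rw [mult, mult, indicator_of_mem hm, indicator_of_mem (this.2 hm)]
      · rw [mult, mult, indicator_of_notMem hm, indicator_of_notMem (fun hh => hm (this.1 hh))]
    · rw [← hFt t]
      have := h.functional_le c hU.measurableSet
      rw [h.preimage_deform hXU] at this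
      simpa only [h.Phi0_pullbackNormal hX] using this
  have hreal : ∀ᶠ t : ℝ in 𝓝 0, deformEnergy X c U 0
        ≤ (functional Phi0 (mult ((fun x => x + t • X x) '' {x | quadU x < c})) U).toReal ∧
      (functional Phi0 (mult ((fun x => x + t • X x) '' {x | quadU x < c})) U).toReal
        ≤ deformEnergy X c U t := by
    filter_upwards [hbounds] with t ⟨h1, h2⟩
    have hne := ne_top_of_le_ne_top ENNReal.ofReal_ne_top h2
    exact ⟨(ENNReal.ofReal_le_iff_le_toReal hne).1 h1, ENNReal.toReal_le_of_le_ofReal (hF0 t) h2⟩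
  refine ⟨hbounds.mono fun t h => ne_top_of_le_ne_top ENNReal.ofReal_ne_top h.2, ?_⟩
  have hmin : IsLocalMin (deformEnergy X c U) 0 := hreal.mono fun t h => h.1.trans h.2
  have hd := (differentiableAt_deformEnergy hX hc hU.measurableSet hUb).hasDerivAt
  rw [hmin.deriv_eq_zero] at hd
  have h00 := hreal.self_of_nhds
  rw [hasDerivAt_iff_isLittleO] at hd ⊢
  -- At `t = 0` the two bounds coincide, so the increment of the functional is between zero and that
  -- of `deformEnergy`, which is `o(t)`.
  refine Asymptotics.IsBigO.trans_isLittleO (.of_bound 1 ?_) hd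
  filter_upwards [hreal] with t ht
  simp only [smul_zero, sub_zero, one_mul, Real.norm_eq_abs]
  rw [le_antisymm h00.2 h00.1, abs_of_nonneg (sub_nonneg.2 ht.1),
    abs_of_nonneg (sub_nonneg.2 (ht.1.trans ht.2))]
  exact sub_le_sub_right ht.2 _

end Deformation

/-! ### Level sets and the foliation -/

theorem frontier_sublevel (c : ℝ) : frontier {x : R6 | quadU x < c} = {x | quadU x = c} := by
  refine (frontier_lt_subset_eq continuous_quadU continuous_const).antisymm fun x hx => ?_
  have hx' : quadU x = c := hx
  rw [frontier, (isOpen_lt continuous_quadU continuous_const).interior_eq]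
  refine ⟨?_, fun h => (ne_of_lt h) hx'⟩
  -- Moving `q` in a direction `v` with `⟨q, v⟩ ≥ 0` lowers `u` by at least `ε² / 2`. This also
  -- works at the vertex of the cone, where the gradient of `u` vanishes.
  obtain ⟨v, hv, hqv⟩ : ∃ v : R3, ‖v‖ = 1 ∧ 0 ≤ inner ℝ (qPart x) v := by
    rcases le_total 0 (inner ℝ (qPart x) (EuclideanSpace.single (0 : Fin 3) (1 : ℝ))) with h | h
    · exact ⟨_, by simp, h⟩
    · refine ⟨-EuclideanSpace.single (0 : Fin 3) (1 : ℝ), by simp, ?_⟩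
      rw [inner_neg_right]; linarith
  have hcont : Continuous fun ε : ℝ => join (pPart x) (qPart x + ε • v) := by fun_prop
  have ht : Tendsto (fun ε : ℝ => join (pPart x) (qPart x + ε • v)) (𝓝[>] 0) (𝓝 x) := by
    have := hcont.tendsto 0
    rw [zero_smul, add_zero, join_pPart_qPart] at this
    exact this.mono_left nhdsWithin_le_nhds
  refine mem_closure_of_tendsto ht ?_
  filter_upwards [self_mem_nhdsWithin] with ε hε
  have hε' : (0 : ℝ) < ε := hε
  have h1 : 0 ≤ ε * inner ℝ (qPart x) v := mul_nonneg hε'.le hqv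
  have h2 : 0 < ε ^ 2 := by positivity
  change quadU _ < c
  rw [← hx', quadU, quadU, pPart_join, qPart_join, norm_add_sq_real, inner_smul_right, norm_smul, hv,
    Real.norm_eq_abs, mul_one, sq_abs]
  linarith

theorem coneS2S2_eq : coneS2S2 = {x | ‖pPart x‖ = ‖qPart x‖} := by
  ext x
  constructor
  · rintro ⟨r, y, -, hp, hq, rfl⟩
    simp [norm_smul, hp, hq]
  · intro hx
    have hx' : ‖pPart x‖ = ‖qPart x‖ := hx
    rcases eq_or_ne ‖pPart x‖ 0 with h | h
    · refine ⟨0, join (EuclideanSpace.single 0 1) (EuclideanSpace.single 0 1), le_rfl,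
        by simp, by simp, ?_⟩
      rw [zero_smul, ← norm_eq_zero, ← sq_eq_zero_iff, norm_sq_eq_add, ← hx', h]
      norm_num
    · refine ⟨‖pPart x‖, ‖pPart x‖⁻¹ • x, norm_nonneg _, ?_, ?_, ?_⟩
      · rw [pPart_smul, norm_smul, norm_inv, norm_norm, inv_mul_cancel₀ h]
      · rw [qPart_smul, norm_smul, norm_inv, norm_norm, ← hx', inv_mul_cancel₀ h]
      · rw [smul_smul, mul_inv_cancel₀ h, one_smul]

theorem quadU_eq_zero_iff (x : R6) : quadU x = 0 ↔ ‖pPart x‖ = ‖qPart x‖ := by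
  rw [quadU, div_eq_zero_iff, or_iff_left two_ne_zero, sub_eq_zero,
    sq_eq_sq₀ (norm_nonneg _) (norm_nonneg _)]

/-- The dilations of `{ε u = 1}`, `ε = ± 1`, foliate `{ε u > 0}`. -/
theorem dilationsFoliate_quadU (ε : ℝ) :
    DilationsFoliate {x : R6 | ε * quadU x = 1} {x | 0 < ε * quadU x} := by
  have hcd : ContDiff ℝ ∞ fun x => ε * quadU x := contDiff_const.mul contDiff_quadU
  refine ⟨isOpen_lt continuous_const hcd.continuous, fun x => √(ε * quadU x),
    fun x hx => (hcd.contDiffAt.sqrt (ne_of_gt hx)).contDiffWithinAt, fun x hx => ?_,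
    fun r hr => ?_⟩
  · have hx' : 0 < ε * quadU x := hx
    refine ⟨Real.sqrt_pos.2 hx', fun h0 => ?_⟩
    have h1 : HasFDerivAt (fun x => ε * quadU x) (ε • innerSL ℝ (gradU x)) x :=
      (hasFDerivAt_quadU x).const_mul ε
    have h2 := h1.sqrt hx'.ne'
    have h3 := congrArg (fun L => L x) (h2.fderiv.symm.trans h0)
    -- Euler's identity: the radial derivative of `u` is `2u`, so `ρ` has no critical point where `ε
    -- u > 0`.
    have h4 : inner ℝ (gradU x) x = 2 * quadU x := by rw [quadU_eq_inner]; ring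
    simp only [smul_apply, innerSL_apply_apply, h4, smul_eq_mul, zero_apply] at h3
    have h5 : 0 < 1 / (2 * √(ε * quadU x)) := by
      have := Real.sqrt_pos.2 hx'
      positivity
    have h6 : 0 < 1 / (2 * √(ε * quadU x)) * (ε * (2 * quadU x)) :=
      mul_pos h5 (by linarith)
    exact h6.ne' h3
  · ext x
    rw [mem_smul_set_iff_inv_smul_mem₀ hr.ne']
    simp only [mem_ofPred_eq, quadU_smul, inv_pow]
    have hr2 : 0 < r ^ 2 := by positivity
    constructor
    · intro h
      have h1 : ε * quadU x = r ^ 2 := by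
        field_simp at h
        linarith
      refine ⟨by rw [h1]; exact hr2, ?_⟩
      rw [h1, Real.sqrt_sq hr.le]
    · rintro ⟨h1, h2⟩
      rw [Real.sqrt_eq_iff_mul_self_eq h1.le hr.le] at h2
      field_simp
      linarith

end ParametricFunctional

theorem mainTheorem2 :
    (coneS2S2 = {x | ‖pPart x‖ = ‖qPart x‖} ∧
      frontier {x | quadU x < 0} = coneS2S2 ∧
      IsMinimizer Phi0 {x | quadU x < 0}) ∧
    (frontier {x | quadU x < 1} = {x | quadU x = 1} ∧
      IsCriticalPoint Phi0 {x | quadU x < 1}) ∧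
    (frontier {x | quadU x < -1} = {x | quadU x = -1} ∧
      IsCriticalPoint Phi0 {x | quadU x < -1}) ∧
    DilationsFoliate {x | quadU x = 1} {x | 0 < quadU x} ∧
    DilationsFoliate {x | quadU x = -1} {x | quadU x < 0} := by
  refine ⟨⟨coneS2S2_eq, ?_, isMinimizer_sublevel 0⟩,
    ⟨frontier_sublevel 1, isCriticalPoint_sublevel one_ne_zero⟩,
    ⟨frontier_sublevel (-1), isCriticalPoint_sublevel (by norm_num)⟩, ?_, ?_⟩
  · rw [frontier_sublevel, coneS2S2_eq]
    ext x
    exact quadU_eq_zero_iff x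
  · simpa only [one_mul] using dilationsFoliate_quadU 1
  · have h := dilationsFoliate_quadU (-1)
    simpa only [neg_mul, one_mul, neg_eq_iff_eq_neg, Left.neg_pos_iff] using h
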